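/- Theorem 3. Let $P,\beta,\gamma>0$ be fixed. For every integer $N\ge 2$ let $H$ and $G$ be independent random row vectors in $\mathbb{C}^{1\times N}$ with i.i.d. $\mathcal{N}_{\mathbb{C}}(0,1)$ entries ($H$ is the channel from Alice, who has $N_A=N$ antennas, to Bob, and $G$ the channel from Alice to Eve; Bob and Eve have $N_B=N_E=1$ antenna each). Let $B=B(N)\in\mathbb{N}$ be the number of feedback bits, and let $\mathcal{V}=\{\tilde v_1,\dots,\tilde v_{2^{B}}\}$ be a random codebook of independent isotropically (Haar-) distributed unit vectors in $\mathbb{C}^{N}$, independent of $(H,G)$. The objects for different $N$ live on one probability space, with arbitrary joint dependence. For fixed $(H,G)$ and a unitary matrix $[V,Z]\in\mathbb{C}^{N\times N}$ with $V\in\mathbb{C}^{N\times 1}$ and $Z\in\mathbb{C}^{N\times(N-1)}$, let $$R(V,Z)=I(u;z)-I(u;y),\qquad z=H(Vu+Zv)+n_B,\qquad y=G(Vu+Zv)+n_E,$$ where $I$ is mutual information and $u\in\mathbb{C}$, $v\in\mathbb{C}^{N-1}$, $n_B,n_E\in\mathbb{C}$ are independent with i.i.d. circularly symmetric complex Gaussian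 entries of variances $\sigma_u^2,\sigma_v^2,\sigma_B^2,\sigma_E^2$ respectively. Here $\sigma_B^2=1$, $\sigma_E^2/\sigma_B^2=\gamma$, and $\sigma_u^2,\sigma_v^2$ depend on $N$ and are determined by the power allocation $\sigma_v^2/\sigma_u^2=\beta$ and the power constraint $\sigma_u^2+(N-1)\sigma_v^2=P$. Let $[\tilde V,Z]$ be a unitary matrix with $HZ=0$ (perfect channel knowledge). Let $\tilde v_j$ be a codeword that minimizes $d^2(\tilde v_i,\tilde V)$ over $1\le i\le 2^{B}$, where $d(\tilde v_i,\tilde V)=1-|\tilde v_i^{H}\tilde V|^2$, and let $\hat Z$ be any matrix for which $[\tilde v_j,\hat Z]$ is unitary (quantized channel knowledge). The instantaneous secrecy-rate loss is $$\Delta R_S=R_S-R_{S,Q},\qquad R_S=R(\tilde V,Z),\qquad R_{S,Q}=R(\tilde v_j,\hat Z).$$ If $N\to\infty$ and $B\to\infty$ with $B/N\to\bar B\in\mathbb{R}$, then almost surely $$\Delta R_S\to\log\left(1+\frac{P}{\beta}\right)+\log\left(1+2^{-\bar B}P\right)-\log\left(1+P+\frac{1-\beta}{\beta}\left(1-2^{-\bar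 B}\right)P\right),$$ where $\log$ is the natural logarithm and mutual information is measured in nats. -/

import Mathlib

open MeasureTheory ProbabilityTheory Filter Topology
open scoped NNReal Matrix

noncomputable section

/-- The circularly symmetric complex Gaussian law of mean `0` and variance `v`: real and imaginary
parts are independent centred real Gaussians of variance `v / 2`. -/
def complexGaussian (v : ℝ≥0) : Measure ℂ :=
  ((gaussianReal 0 (v / 2)).prod (gaussianReal 0 (v / 2))).map
    Complex.measurableEquivRealProd.symm

/-- The law of a random vector in `ℂᵏ` with i.i.d. circularly symmetric Gaussian entries of
variance `v`. -/
def gaussianVector (k : ℕ) (v : ℝ≥0) : Measure (Fin k → ℂ) :=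
  Measure.pi fun _ => complexGaussian v

/-- Matrices carry the product sigma-algebra of their entries. -/
instance instMeasurableSpaceMatrixFin {m n : ℕ} : MeasurableSpace (Matrix (Fin m) (Fin n) ℂ) :=
  inferInstanceAs (MeasurableSpace (Fin m → Fin n → ℂ))

/-- The law of a random `m × n` matrix with i.i.d. circularly symmetric Gaussian entries of
variance `v`. -/
def gaussianMatrix (m n : ℕ) (v : ℝ≥0) : Measure (Matrix (Fin m) (Fin n) ℂ) :=
  Measure.pi fun _ : Fin m => Measure.pi fun _ : Fin n => complexGaussian v

/-- `ν` is the isotropic (Haar) law on the `n × m` complex matrices with orthonormal columns: the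
probability measure carried by those matrices that is invariant under left multiplication by
unitary matrices. -/
structure IsIsotropicUnitary {n m : ℕ} (ν : Measure (Matrix (Fin n) (Fin m) ℂ)) : Prop where
  isProb : IsProbabilityMeasure ν
  orthonormal : ∀ᵐ W ∂ν, Wᴴ * W = 1
  invariant : ∀ U ∈ Matrix.unitaryGroup (Fin n) ℂ, ν.map (fun W => U * W) = ν

/-- The mutual information `I(X; Y)`, in nats: the Kullback-Leibler divergence of the joint law of
`(X, Y)` from the product of the marginal laws. -/
def mutualInfo {Ω 𝓧 𝓨 : Type*} [MeasurableSpace Ω] [MeasurableSpace 𝓧] [MeasurableSpace 𝓨]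
    (μ : Measure Ω) (X : Ω → 𝓧) (Y : Ω → 𝓨) : ℝ :=
  (InformationTheory.klDiv (μ.map fun ω => (X ω, Y ω)) ((μ.map X).prod (μ.map Y))).toReal

/-- The mutual information `I(u; A x + n)` between the information vector `u` and the signal
received over the channel `A`, when the transmitted signal is `x = V u + Z v`. Here `u` (the
information vector), `v` (the artificial noise) and `n` (the receiver noise) are independent
Gaussian vectors with i.i.d. entries of variances `σu2`, `σv2`, `σn2`; the matrices `A`, `V`, `Z`
are fixed. -/
def channelInfo {r n m k : ℕ} (A : Matrix (Fin r) (Fin n) ℂ) (V : Matrix (Fin n) (Fin m) ℂ)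
    (Z : Matrix (Fin n) (Fin k) ℂ) (σu2 σv2 σn2 : ℝ≥0) : ℝ :=
  mutualInfo
    ((gaussianVector m σu2).prod ((gaussianVector k σv2).prod (gaussianVector r σn2)))
    (fun t => t.1)
    (fun t => A *ᵥ (V *ᵥ t.1 + Z *ᵥ t.2.1) + t.2.2)

/-- The instantaneous secrecy rate `I(u; z) - I(u; y)` for the precoder `[V, Z]` and Gaussian
inputs, where `z` and `y` are the signals received over the main channel `H` (noise variance
`σB2`) and over the eavesdropper's channel `G` (noise variance `σE2`). -/
def secrecyRate {NB NE n m k : ℕ} (H : Matrix (Fin NB) (Fin n) ℂ) (G : Matrix (Fin NE) (Fin n) ℂ)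
    (V : Matrix (Fin n) (Fin m) ℂ) (Z : Matrix (Fin n) (Fin k) ℂ) (σu2 σv2 σB2 σE2 : ℝ≥0) : ℝ :=
  channelInfo H V Z σu2 σv2 σB2 - channelInfo G V Z σu2 σv2 σE2

/-- The block matrix `[V, Z]` is unitary (in particular square). -/
def IsUnitaryPrecoder {n m k : ℕ} (V : Matrix (Fin n) (Fin m) ℂ) (Z : Matrix (Fin n) (Fin k) ℂ) :
    Prop :=
  (Matrix.fromCols V Z)ᴴ * Matrix.fromCols V Z = 1 ∧
    Matrix.fromCols V Z * (Matrix.fromCols V Z)ᴴ = 1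

/-- The chordal distance `m - Tr(Vᴴ W Wᴴ V)` between two `n × m` matrices `W`, `V` with orthonormal
columns (the trace is real). -/
def chordalDist {n m : ℕ} (W V : Matrix (Fin n) (Fin m) ℂ) : ℝ :=
  (m : ℝ) - (Matrix.trace (Vᴴ * W * Wᴴ * V)).re

end

/-! With one receive antenna, signal and noise are scalar Gaussians, so each mutual information is
`log (1 + SINR)` (`channelInfo_eq_log`). Unitarity of the precoder gives `‖AZ‖² = ‖A‖² - |AV|²`, so
both rates depend only on `N σu2 → P / β`, `N σv2 → P` and five random scalars: `‖h‖² / N → 1`,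
`‖g‖² / N → 1`, Eve's normalized gain `|⟨g, h⟩|² / (N ‖h‖²) → 0` along Bob's direction, the
quantization error `d → D = 2 ^ (-Bbar)`, and Eve's normalized gain `|g v_j|² / N → 0` along the
selected codeword. The theorem is then continuity of the logarithm (`tendsto_secrecyRateLoss`).

The rate `2 ^ (-Bbar)` arises because an isotropic unit vector lies within distance `x` of a given
direction with probability exactly `x ^ (N - 1)`, so about `2 ^ B * x ^ (N - 1)` codewords do. This
is exponentially small for `x < D` and exponentially large for `x > D` (`ae_eventually_near_imp_le`,
`ae_eventually_exists_near`).

The selected index may depend on everything, including `G` in case of ties, and is not assumed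
measurable. Eve's gain is therefore bounded simultaneously for all codewords at distance at most
`x`, with `x` slightly above `D`: few enough of them exist for a union bound to succeed.

Every bound is exponential in `N`, so Borel–Cantelli gives almost sure limits from the law at each
single `N`, whatever the dependence between different `N`. -/

/-! ### Complex Gaussian laws: linear forms, density, Laplace transform and tail -/

instance isProbabilityMeasure_complexGaussian (v : ℝ≥0) :
    IsProbabilityMeasure (complexGaussian v) :=
  Measure.isProbabilityMeasure_map (Complex.measurableEquivRealProd.symm.measurable.aemeasurable)

instance isProbabilityMeasure_gaussianVector (k : ℕ) (v : ℝ≥0) :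
    IsProbabilityMeasure (gaussianVector k v) :=
  inferInstanceAs (IsProbabilityMeasure (Measure.pi fun _ => complexGaussian v))

lemma charFun_complexGaussian (v : ℝ≥0) (t : ℂ) :
    charFun (complexGaussian v) t = Complex.exp (-(v * ‖t‖ ^ 2 / 4 : ℝ)) := by
  rw [charFun_apply, complexGaussian,
    integral_map_equiv]
  have h : ∀ x : ℝ × ℝ, Complex.exp
      ((inner ℝ (Complex.measurableEquivRealProd.symm x) t : ℝ) * Complex.I)
      = Complex.exp (t.re * x.1 * Complex.I) * Complex.exp (t.im * x.2 * Complex.I) := by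
    intro x
    rw [← Complex.exp_add]
    congr 1
    simp only [Complex.inner, Complex.measurableEquivRealProd_symm_apply, Complex.mul_re,
      Complex.conj_re, Complex.conj_im]
    push_cast
    ring
  simp_rw [h]
  rw [integral_prod_mul (fun x : ℝ => Complex.exp (t.re * x * Complex.I))
    (fun x : ℝ => Complex.exp (t.im * x * Complex.I)), ← charFun_apply_real, ← charFun_apply_real,
    charFun_gaussianReal, charFun_gaussianReal, ← Complex.exp_add]
  congr 1
  rw [Complex.sq_norm, Complex.normSq_apply]
  push_cast
  ring

/-- A linear form of an i.i.d. complex Gaussian vector is complex Gaussian. -/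
lemma map_sum_mul_gaussianVector {k : ℕ} (v : ℝ≥0) (c : Fin k → ℂ) :
    (gaussianVector k v).map (fun x => ∑ i, c i * x i) =
      complexGaussian (v * ∑ i, ‖c i‖₊ ^ 2) := by
  have hmeas : Measurable fun x : Fin k → ℂ => ∑ i, c i * x i := by fun_prop
  have : IsProbabilityMeasure ((gaussianVector k v).map (fun x => ∑ i, c i * x i)) :=
    Measure.isProbabilityMeasure_map hmeas.aemeasurable
  apply Measure.ext_of_charFun
  have hm : ∀ i, AEMeasurable (fun z : ℂ => c i * z) (complexGaussian v) := fun i => by fun_prop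
  have hp : ∀ i, IsProbabilityMeasure ((complexGaussian v).map (fun z : ℂ => c i * z)) :=
    fun i => Measure.isProbabilityMeasure_map (hm i)
  have h1 : (gaussianVector k v).map (fun x => ∑ i, c i * x i) =
      (Measure.pi fun i => (complexGaussian v).map (fun z => c i * z)).map
        (fun p => ∑ i, p i) := by
    rw [gaussianVector, ← Measure.pi_map_pi hm, Measure.map_map (by fun_prop) (by fun_prop)]
    rfl
  rw [h1, charFun_map_sum_pi_eq_prod]
  ext t
  -- The real adjoint of multiplication by `c i` is multiplication by its conjugate; the Gaussian
  -- characteristic function then sees only `‖c i‖ * ‖t‖`.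
  have h2 : ∀ i, charFun ((complexGaussian v).map (fun z : ℂ => c i * z)) t =
      charFun (complexGaussian v) (starRingEnd ℂ (c i) * t) := by
    intro i
    rw [charFun_apply, charFun_apply, integral_map (hm i) (by fun_prop)]
    congr 1
    ext z
    congr 3
    simp only [Complex.inner, Complex.mul_re, Complex.conj_re, Complex.conj_im, Complex.mul_im]
    ring
  rw [Finset.prod_apply]
  simp_rw [h2, charFun_complexGaussian]
  rw [← Complex.exp_sum]
  congr 1
  push_cast
  simp only [norm_mul, RCLike.norm_conj, mul_pow, Complex.ofReal_mul,
    Finset.mul_sum, Finset.sum_mul, Finset.sum_div, Finset.sum_neg_distrib]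
  congr 1
  refine Finset.sum_congr rfl fun i _ => ?_
  ring

lemma complexGaussian_eq_withDensity {v : ℝ≥0} (hv : v ≠ 0) :
    complexGaussian v = (volume : Measure ℂ).withDensity
      (fun z => ENNReal.ofReal (Real.exp (-‖z‖ ^ 2 / v) / (Real.pi * v))) := by
  have hv2 : v / 2 ≠ 0 := by positivity
  have hv' : (0 : ℝ) < v := by positivity
  have hm : Measurable (gaussianPDF 0 (v / 2)) := measurable_gaussianPDF _ _
  rw [complexGaussian, gaussianReal_of_var_ne_zero _ hv2, prod_withDensity hm hm,
    ← Complex.volume_preserving_equiv_real_prod.symm.map_eq]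
  refine Measure.ext_of_lintegral _ fun φ hφ => ?_
  have hm2 : Measurable fun z : ℂ =>
      ENNReal.ofReal (Real.exp (-‖z‖ ^ 2 / v) / (Real.pi * v)) := by fun_prop
  rw [lintegral_map_equiv, lintegral_withDensity_eq_lintegral_mul _ (by fun_prop) (by fun_prop),
    lintegral_withDensity_eq_lintegral_mul _ hm2 hφ, lintegral_map_equiv]
  rw [← Measure.volume_eq_prod]
  refine lintegral_congr fun x => ?_
  simp only [Pi.mul_apply]
  congr 1
  rw [gaussianPDF, gaussianPDF, ← ENNReal.ofReal_mul (gaussianPDFReal_nonneg _ _ _)]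
  congr 1
  simp only [gaussianPDFReal, Complex.measurableEquivRealProd_symm_apply, Complex.sq_norm,
    Complex.normSq_apply, sub_zero]
  have : (2 * Real.pi * ((v / 2 : ℝ≥0) : ℝ)) = Real.pi * v := by push_cast; ring
  rw [this]
  have e : ∀ a b : ℝ, (√(Real.pi * v))⁻¹ * Real.exp a * ((√(Real.pi * v))⁻¹ * Real.exp b) =
      Real.exp (a + b) / (Real.pi * v) := by
    intro a b
    rw [Real.exp_add, mul_mul_mul_comm, ← mul_inv, Real.mul_self_sqrt (by positivity)]
    field_simp
  rw [e]
  congr 2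
  push_cast
  field_simp
  ring

/-- This is the Laplace transform of `‖z‖²`, an exponential variable of mean one. Negative `c` is
allowed because the upper Chernoff bound needs it. -/
lemma lintegral_exp_neg_mul_sq_norm_complexGaussian {c : ℝ} (hc : -1 < c) :
    ∫⁻ z, ENNReal.ofReal (Real.exp (-c * ‖z‖ ^ 2)) ∂complexGaussian 1 =
      ENNReal.ofReal (1 / (1 + c)) := by
  have hc' : 0 < 1 + c := by linarith
  rw [complexGaussian_eq_withDensity one_ne_zero,
    lintegral_withDensity_eq_lintegral_mul _ (by fun_prop) (by fun_prop)]
  have h : ∀ z : ℂ, (((fun z : ℂ => ENNReal.ofReal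
      (Real.exp (-‖z‖ ^ 2 / (1 : ℝ≥0)) / (Real.pi * (1 : ℝ≥0)))) *
      fun z => ENNReal.ofReal (Real.exp (-c * ‖z‖ ^ 2))) : ℂ → ENNReal) z =
      ENNReal.ofReal (Real.exp (-(1 + c) * ‖z‖ ^ 2) / Real.pi) := by
    intro z
    rw [Pi.mul_apply, ← ENNReal.ofReal_mul (by positivity)]
    congr 1
    rw [div_mul_eq_mul_div, ← Real.exp_add]
    simp only [NNReal.coe_one, mul_one, div_one]
    congr 2
    ring
  have hint := GaussianFourier.integral_rexp_neg_mul_sq_norm (V := ℂ) hc'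
  -- A nonzero integral forces integrability, since the integral of a non-integrable function is
  -- zero by convention.
  have hpos : 0 < ∫ z : ℂ, Real.exp (-(1 + c) * ‖z‖ ^ 2) := by
    rw [hint]; positivity
  have hI : Integrable fun z : ℂ => Real.exp (-(1 + c) * ‖z‖ ^ 2) := by
    by_contra hn
    rw [integral_undef hn] at hpos
    exact lt_irrefl _ hpos
  rw [lintegral_congr h, ← ofReal_integral_eq_lintegral_ofReal (hI.div_const _)
    (ae_of_all _ fun z => by positivity), integral_div, hint]
  congr 1
  simp only [Complex.finrank_real_complex]
  norm_num
  field_simp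

/-- In polar coordinates the radial integrand `r * exp (-r ^ 2)` has an elementary primitive, and
the angle contributes `2π`. -/
lemma complexGaussian_one_le_sq_norm {t : ℝ} (ht : 0 ≤ t) :
    complexGaussian 1 {z | t ≤ ‖z‖ ^ 2} = ENNReal.ofReal (Real.exp (-t)) := by
  have hms : MeasurableSet {z : ℂ | t ≤ ‖z‖ ^ 2} := measurableSet_le (by fun_prop) (by fun_prop)
  rw [complexGaussian_eq_withDensity one_ne_zero, withDensity_apply _ hms,
    ← lintegral_indicator hms, ← Complex.lintegral_comp_polarCoord_symm]
  have hd : ∀ r ∈ Set.Ioi √t, HasDerivAt (fun r : ℝ => -Real.exp (-r ^ 2) / 2)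
      (r * Real.exp (-r ^ 2)) r := by
    intro r _
    have h1 : HasDerivAt (fun r : ℝ => -r ^ 2) (-(2 * r)) r := by
      simpa [Pi.neg_def] using (hasDerivAt_pow 2 r).fun_neg
    exact (h1.exp.fun_neg.div_const 2).congr_deriv (by ring)
  have hlim : Tendsto (fun r : ℝ => -Real.exp (-r ^ 2) / 2) atTop (𝓝 0) := by
    have : Tendsto (fun r : ℝ => Real.exp (-r ^ 2)) atTop (𝓝 0) :=
      Real.tendsto_exp_atBot.comp (tendsto_neg_atTop_atBot.comp (tendsto_pow_atTop two_ne_zero))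
    simpa using this.neg.div_const 2
  have hcont : ContinuousWithinAt (fun r : ℝ => -Real.exp (-r ^ 2) / 2) (Set.Ici √t) √t :=
    Continuous.continuousWithinAt (by fun_prop)
  have hnn : ∀ r ∈ Set.Ioi √t, 0 ≤ r * Real.exp (-r ^ 2) := fun r hr =>
    mul_nonneg ((Real.sqrt_nonneg t).trans (le_of_lt hr)) (Real.exp_nonneg _)
  have hI := integrableOn_Ioi_deriv_of_nonneg hcont hd hnn hlim
  have hval := integral_Ioi_of_hasDerivAt_of_nonneg hcont hd hnn hlim
  have hpi := Real.pi_pos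
  have hset : ∫⁻ r in Set.Ioi (0 : ℝ), ENNReal.ofReal r * (Set.Ici √t).indicator
      (fun r => ENNReal.ofReal (Real.exp (-r ^ 2) / Real.pi)) r =
      ENNReal.ofReal (Real.exp (-t) / (2 * Real.pi)) := by
    have h1 : ∀ r : ℝ, ENNReal.ofReal r * (Set.Ici √t).indicator
      (fun r => ENNReal.ofReal (Real.exp (-r ^ 2) / Real.pi)) r = (Set.Ici √t).indicator
        (fun r => ENNReal.ofReal r * ENNReal.ofReal (Real.exp (-r ^ 2) / Real.pi)) r := by
      intro r
      by_cases h : r ∈ Set.Ici √t <;> simp [h]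
    simp_rw [h1]
    rw [setLIntegral_indicator measurableSet_Ici]
    have h2 : (Set.Ici √t ∩ Set.Ioi 0 : Set ℝ) =ᵐ[volume] Set.Ioi √t := by
      have h3 : (Set.Ici √t ∩ Set.Ioi 0 : Set ℝ) =ᵐ[volume] (Set.Ioi √t ∩ Set.Ioi 0 : Set ℝ) :=
        (Ioi_ae_eq_Ici.symm).inter (ae_eq_refl _)
      rwa [Set.Ioi_inter_Ioi, sup_eq_left.2 (Real.sqrt_nonneg t)] at h3
    rw [setLIntegral_congr h2]
    have h4 : ∀ r ∈ Set.Ioi √t,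
        ENNReal.ofReal r * ENNReal.ofReal (Real.exp (-r ^ 2) / Real.pi) =
        ENNReal.ofReal (r * Real.exp (-r ^ 2) / Real.pi) := fun r hr => by
      rw [← ENNReal.ofReal_mul ((Real.sqrt_nonneg t).trans (le_of_lt hr)), mul_div_assoc]
    rw [setLIntegral_congr_fun measurableSet_Ioi h4,
      ← ofReal_integral_eq_lintegral_ofReal (hI.div_const _), integral_div, hval]
    · rw [Real.sq_sqrt ht]
      congr 1
      field_simp
      ring
    · filter_upwards [ae_restrict_mem measurableSet_Ioi] with r hr
      exact div_nonneg (hnn r hr) hpi.le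
  have hprod : ∀ p ∈ polarCoord.target, ENNReal.ofReal p.1 • ({z : ℂ | t ≤ ‖z‖ ^ 2}.indicator
      (fun z => ENNReal.ofReal (Real.exp (-‖z‖ ^ 2 / (1 : ℝ≥0)) / (Real.pi * (1 : ℝ≥0))))
        (Complex.polarCoord.symm p)) =
      (ENNReal.ofReal p.1 * (Set.Ici √t).indicator
      (fun r => ENNReal.ofReal (Real.exp (-r ^ 2) / Real.pi)) p.1) * 1 := by
    intro p hp
    have hp0 : 0 < p.1 := hp.1
    have hn : ‖Complex.polarCoord.symm p‖ = p.1 := by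
      rw [Complex.norm_polarCoord_symm, abs_of_pos hp0]
    rw [smul_eq_mul, mul_one]
    congr 1
    by_cases h : √t ≤ p.1
    · have h' : t ≤ p.1 ^ 2 := (Real.sqrt_le_left hp0.le).1 h
      rw [Set.indicator_of_mem (by simpa [hn] using h'), Set.indicator_of_mem (by exact h), hn]
      simp
    · have h' : ¬ t ≤ p.1 ^ 2 := fun h' => h ((Real.sqrt_le_left hp0.le).2 h')
      rw [Set.indicator_of_notMem (by simpa [hn] using h'),
        Set.indicator_of_notMem (by exact h)]
  rw [setLIntegral_congr_fun (by exact measurableSet_Ioi.prod measurableSet_Ioo) hprod,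
    polarCoord_target, Measure.volume_eq_prod, ← Measure.prod_restrict,
    lintegral_prod_mul (f := fun r => ENNReal.ofReal r * (Set.Ici √t).indicator
      (fun r => ENNReal.ofReal (Real.exp (-r ^ 2) / Real.pi)) r) (g := fun _ => 1) ?_
      (by fun_prop), hset]
  · rw [lintegral_one, Measure.restrict_apply_univ, Real.volume_Ioo,
      ← ENNReal.ofReal_mul (by positivity)]
    congr 1
    field_simp
    ring
  · exact (ENNReal.measurable_ofReal.mul
      (Measurable.indicator (by fun_prop) measurableSet_Ici)).aemeasurable

/-! ### Mutual information of a scalar Gaussian channel -/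

/-- The Kullback-Leibler divergence of an exponential density is the integral of the exponent. -/
lemma toReal_klDiv_of_eq_withDensity_exp {α : Type*} [MeasurableSpace α] {μ ν : Measure α}
    [IsProbabilityMeasure μ] [IsProbabilityMeasure ν] {g : α → ℝ} (hg : Measurable g)
    (hμ : μ = ν.withDensity fun x => ENNReal.ofReal (Real.exp (g x))) :
    (InformationTheory.klDiv μ ν).toReal = ∫ x, g x ∂μ := by
  have hac : μ ≪ ν := hμ ▸ withDensity_absolutelyContinuous _ _
  rw [InformationTheory.toReal_klDiv_of_measure_eq hac (by simp)]
  refine integral_congr_ae (hac.ae_le ?_)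
  have := Measure.rnDeriv_withDensity ν
    (f := fun x => ENNReal.ofReal (Real.exp (g x))) (by fun_prop)
  rw [← hμ] at this
  filter_upwards [this] with x hx
  rw [llr, hx, ENNReal.toReal_ofReal (Real.exp_nonneg _), Real.log_exp]

lemma integrable_sq_norm_complexGaussian (v : ℝ≥0) :
    Integrable (fun z => ‖z‖ ^ 2) (complexGaussian v) := by
  rw [complexGaussian, integrable_map_equiv]
  have h : Integrable (fun x : ℝ => x ^ 2) (gaussianReal 0 (v / 2)) :=
    (memLp_id_gaussianReal (μ := 0) (v := v / 2) 2).integrable_sq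
  refine ((h.comp_fst _).add (h.comp_snd _)).congr (ae_of_all _ fun x => ?_)
  simp only [Pi.add_apply, Function.comp_apply, Complex.measurableEquivRealProd_symm_apply,
    Complex.sq_norm, Complex.normSq_apply]
  ring

lemma integral_sq_norm_complexGaussian (v : ℝ≥0) :
    ∫ z, ‖z‖ ^ 2 ∂complexGaussian v = v := by
  have h : Integrable (fun x : ℝ => x ^ 2) (gaussianReal 0 (v / 2)) :=
    (memLp_id_gaussianReal (μ := 0) (v := v / 2) 2).integrable_sq
  have hv : ∫ x, x ^ 2 ∂gaussianReal 0 (v / 2) = v / 2 := by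
    have := variance_fun_id_gaussianReal (μ := 0) (v := v / 2)
    rw [variance_of_integral_eq_zero (by fun_prop) (by simp)] at this
    simpa using this
  rw [complexGaussian, integral_map_equiv]
  have e : ∀ x : ℝ × ℝ, ‖Complex.measurableEquivRealProd.symm x‖ ^ 2 = x.1 ^ 2 + x.2 ^ 2 := by
    intro x
    simp only [Complex.measurableEquivRealProd_symm_apply, Complex.sq_norm, Complex.normSq_apply]
    ring
  simp_rw [e]
  rw [integral_add (h.comp_fst _) (h.comp_snd _), integral_fun_fst (fun x : ℝ => x ^ 2),
    integral_fun_snd (fun x : ℝ => x ^ 2), hv]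
  simp

lemma map_eval_gaussianVector_one (v : ℝ≥0) :
    (gaussianVector 1 v).map (fun x => x 0) = complexGaussian v := by
  simpa using map_sum_mul_gaussianVector (k := 1) v 1

lemma eq_gaussianVector_one {ν : Measure (Fin 1 → ℂ)} {v : ℝ≥0}
    (h : ν.map (fun x => x 0) = complexGaussian v) : ν = gaussianVector 1 v := by
  have hid : ∀ ν : Measure (Fin 1 → ℂ), ν = (ν.map (fun x => x 0)).map (fun z _ => z) := by
    intro ν
    rw [Measure.map_map (by fun_prop) (by fun_prop)]
    have : ((fun (z : ℂ) (_ : Fin 1) => z) ∘ fun x : Fin 1 → ℂ => x 0) = id := by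
      ext x i
      simp [Subsingleton.elim i 0]
    rw [this, Measure.map_id]
  rw [hid ν, h, ← map_eval_gaussianVector_one, ← hid]

lemma map_add_prod_complexGaussian (v w : ℝ≥0) :
    ((complexGaussian v).prod (complexGaussian w)).map (fun p => p.1 + p.2) =
      complexGaussian (v + w) := by
  have : IsProbabilityMeasure
      (((complexGaussian v).prod (complexGaussian w)).map (fun p => p.1 + p.2)) :=
    Measure.isProbabilityMeasure_map (by fun_prop)
  apply Measure.ext_of_charFun
  rw [charFun_map_add_prod_eq_mul]
  ext t
  rw [Pi.mul_apply, charFun_complexGaussian, charFun_complexGaussian, charFun_complexGaussian,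
    ← Complex.exp_add]
  congr 1
  push_cast
  ring

lemma map_mul_complexGaussian (v : ℝ≥0) (a : ℂ) :
    (complexGaussian v).map (fun z => a * z) = complexGaussian (‖a‖₊ ^ 2 * v) := by
  rw [← map_eval_gaussianVector_one, Measure.map_map (by fun_prop) (by fun_prop)]
  have := map_sum_mul_gaussianVector (k := 1) v (fun _ => a)
  simp only [Finset.univ_unique, Fin.default_eq_zero, Finset.sum_singleton] at this
  rw [mul_comm, ← this]
  rfl

/-- The joint law of the input and the output of a scalar Gaussian channel. -/
noncomputable def channelLaw (a : ℂ) (v s : ℝ≥0) : Measure ((Fin 1 → ℂ) × (Fin 1 → ℂ)) :=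
  ((gaussianVector 1 v).prod (complexGaussian s)).map
    (fun p => (p.1, fun _ => a * p.1 0 + p.2))

lemma map_output_channel (a : ℂ) (v s : ℝ≥0) :
    ((gaussianVector 1 v).prod (complexGaussian s)).map (fun p => a * p.1 0 + p.2) =
      complexGaussian (‖a‖₊ ^ 2 * v + s) := by
  have h1 : ((gaussianVector 1 v).prod (complexGaussian s)).map
      (Prod.map (fun x => a * x 0) id) =
      (complexGaussian (‖a‖₊ ^ 2 * v)).prod (complexGaussian s) := by
    rw [← Measure.map_prod_map _ _ (by fun_prop) (by fun_prop), Measure.map_id,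
      ← map_mul_complexGaussian,
      ← map_eval_gaussianVector_one v, Measure.map_map (by fun_prop) (by fun_prop)]
    rfl
  rw [← map_add_prod_complexGaussian, ← h1, Measure.map_map (by fun_prop) (by fun_prop)]
  rfl

/-- Given the input, the output is Gaussian with mean `a * u` and variance `s`, so the density is a
ratio of two Gaussian densities in the output alone. The input needs no Lebesgue density, and `v =
0` is allowed. -/
lemma channelLaw_eq_withDensity (a : ℂ) (v : ℝ≥0) {s : ℝ≥0} (hs : s ≠ 0) :
    channelLaw a v s =
      ((gaussianVector 1 v).prod (gaussianVector 1 (‖a‖₊ ^ 2 * v + s))).withDensity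
        fun p => ENNReal.ofReal (Real.exp (Real.log (((‖a‖₊ ^ 2 * v + s : ℝ≥0) : ℝ) / s) +
          ‖p.2 0‖ ^ 2 / (‖a‖₊ ^ 2 * v + s : ℝ≥0) - ‖p.2 0 - a * p.1 0‖ ^ 2 / s)) := by
  set τ : ℝ≥0 := ‖a‖₊ ^ 2 * v + s with hτ
  have hτ0 : τ ≠ 0 := by positivity
  have hs' : (0 : ℝ) < s := by positivity
  have hτ' : (0 : ℝ) < τ := by positivity
  have hpi := Real.pi_pos
  have hm : Measurable fun p : (Fin 1 → ℂ) × (Fin 1 → ℂ) =>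
      ENNReal.ofReal (Real.exp (Real.log ((τ : ℝ) / s) +
          ‖p.2 0‖ ^ 2 / τ - ‖p.2 0 - a * p.1 0‖ ^ 2 / s)) := by fun_prop
  refine Measure.ext_of_lintegral _ fun φ hφ => ?_
  rw [channelLaw, lintegral_map hφ (by fun_prop),
    lintegral_withDensity_eq_lintegral_mul _ hm hφ,
    lintegral_prod _ (by fun_prop), lintegral_prod _ (by fun_prop)]
  refine lintegral_congr fun u => ?_
  have hY : ∀ f : (Fin 1 → ℂ) → ENNReal, Measurable f →
      ∫⁻ Y, f Y ∂gaussianVector 1 τ = ∫⁻ y, f (fun _ => y) ∂complexGaussian τ := by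
    intro f hf
    rw [← map_eval_gaussianVector_one, lintegral_map (by fun_prop) (by fun_prop)]
    refine lintegral_congr fun Y => ?_
    congr 1
    ext i
    rw [Subsingleton.elim i 0]
  rw [hY _ (by fun_prop), complexGaussian_eq_withDensity hs, complexGaussian_eq_withDensity hτ0,
    lintegral_withDensity_eq_lintegral_mul _ (by fun_prop) (by fun_prop),
    lintegral_withDensity_eq_lintegral_mul _ (by fun_prop) (by fun_prop),
    -- Translation by the signal turns the noise variable into the output variable.
    ← lintegral_sub_right_eq_self _ (a * u 0)]
  refine lintegral_congr fun y => ?_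
  simp only [Pi.mul_apply, add_sub_cancel]
  rw [← mul_assoc, ← ENNReal.ofReal_mul (by positivity)]
  congr 2
  rw [sub_eq_add_neg (Real.log _ + _), Real.exp_add, Real.exp_add, Real.exp_log (by positivity),
    neg_div, neg_div]
  have : Real.exp (-(‖y‖ ^ 2 / τ)) * Real.exp (‖y‖ ^ 2 / τ) = 1 := by
    rw [← Real.exp_add, neg_add_cancel, Real.exp_zero]
  field_simp
  exact this.symm

/-- The output power divided by `τ` and the noise power divided by `s` both have mean one, so the
quadratic terms cancel and only `log (τ / s)` survives. -/
lemma toReal_klDiv_channelLaw (a : ℂ) (v : ℝ≥0) {s : ℝ≥0} (hs : s ≠ 0) :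
    (InformationTheory.klDiv (channelLaw a v s)
      ((gaussianVector 1 v).prod (gaussianVector 1 (‖a‖₊ ^ 2 * v + s)))).toReal =
      Real.log (1 + ‖a‖ ^ 2 * v / s) := by
  have hprob : IsProbabilityMeasure (channelLaw a v s) :=
    Measure.isProbabilityMeasure_map (by fun_prop)
  rw [toReal_klDiv_of_eq_withDensity_exp (by fun_prop) (channelLaw_eq_withDensity a v hs)]
  set τ : ℝ≥0 := ‖a‖₊ ^ 2 * v + s with hτ
  have hs' : (0 : ℝ) < s := by positivity
  have hτ' : (0 : ℝ) < τ := by positivity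
  rw [channelLaw, integral_map (by fun_prop) (Measurable.aestronglyMeasurable (by fun_prop))]
  simp only [add_sub_cancel_left]
  have hout := map_output_channel a v s
  rw [← hτ] at hout
  have hi1 : Integrable (fun p : (Fin 1 → ℂ) × ℂ => ‖a * p.1 0 + p.2‖ ^ 2)
      ((gaussianVector 1 v).prod (complexGaussian s)) := by
    have := integrable_sq_norm_complexGaussian τ
    rw [← hout] at this
    exact this.comp_measurable (by fun_prop)
  have hi2 : Integrable (fun p : (Fin 1 → ℂ) × ℂ => ‖p.2‖ ^ 2)
      ((gaussianVector 1 v).prod (complexGaussian s)) :=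
    (integrable_sq_norm_complexGaussian s).comp_snd _
  have hv1 : ∫ p : (Fin 1 → ℂ) × ℂ, ‖a * p.1 0 + p.2‖ ^ 2
      ∂(gaussianVector 1 v).prod (complexGaussian s) = τ := by
    rw [← integral_sq_norm_complexGaussian τ, ← hout, integral_map (by fun_prop) (by fun_prop)]
  have hv2 : ∫ p : (Fin 1 → ℂ) × ℂ, ‖p.2‖ ^ 2
      ∂(gaussianVector 1 v).prod (complexGaussian s) = s := by
    rw [integral_fun_snd (fun z : ℂ => ‖z‖ ^ 2), integral_sq_norm_complexGaussian]
    simp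
  have hi3 : Integrable (fun p : (Fin 1 → ℂ) × ℂ =>
      Real.log ((τ : ℝ) / s) + ‖a * p.1 0 + p.2‖ ^ 2 / τ)
      ((gaussianVector 1 v).prod (complexGaussian s)) :=
    (integrable_const _).add (hi1.div_const _)
  rw [integral_sub hi3 (hi2.div_const _),
    integral_add (integrable_const _) (hi1.div_const _), integral_div, integral_div, hv1, hv2,
    integral_const]
  simp only [probReal_univ, smul_eq_mul, one_mul]
  rw [div_self hs'.ne', div_self hτ'.ne', add_sub_cancel_right]
  congr 1
  rw [hτ]
  push_cast
  field_simp
  ring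

/-- The mutual information over a Gaussian channel with one receive antenna, one information
symbol and artificial noise. -/
lemma channelInfo_eq_log {n k : ℕ} (A : Matrix (Fin 1) (Fin n) ℂ) (V : Matrix (Fin n) (Fin 1) ℂ)
    (Z : Matrix (Fin n) (Fin k) ℂ) (σu2 σv2 : ℝ≥0) {σn2 : ℝ≥0} (hσ : σn2 ≠ 0) :
    channelInfo A V Z σu2 σv2 σn2 =
      Real.log (1 + ‖(A * V) 0 0‖ ^ 2 * σu2 / (σv2 * ∑ i, ‖(A * Z) 0 i‖ ^ 2 + σn2)) := by
  set s : ℝ≥0 := σv2 * ∑ i, ‖(A * Z) 0 i‖₊ ^ 2 + σn2 with hs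
  have hs0 : s ≠ 0 := by positivity
  set a : ℂ := (A * V) 0 0 with ha
  set ν := (gaussianVector 1 σu2).prod ((gaussianVector k σv2).prod (gaussianVector 1 σn2))
    with hν
  have hnoise : ((gaussianVector k σv2).prod (gaussianVector 1 σn2)).map
      (fun q => (∑ i, (A * Z) 0 i * q.1 i) + q.2 0) = complexGaussian s := by
    have h1 : ((gaussianVector k σv2).prod (gaussianVector 1 σn2)).map
        (Prod.map (fun x => ∑ i, (A * Z) 0 i * x i) (fun x => x 0)) =
        (complexGaussian (σv2 * ∑ i, ‖(A * Z) 0 i‖₊ ^ 2)).prod (complexGaussian σn2) := by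
      rw [← Measure.map_prod_map _ _ (by fun_prop) (by fun_prop), map_eval_gaussianVector_one,
        map_sum_mul_gaussianVector]
    rw [hs, ← map_add_prod_complexGaussian, ← h1, Measure.map_map (by fun_prop) (by fun_prop)]
    rfl
  have hpair : ν.map (Prod.map id (fun q : (Fin k → ℂ) × (Fin 1 → ℂ) =>
      (∑ i, (A * Z) 0 i * q.1 i) + q.2 0)) =
      (gaussianVector 1 σu2).prod (complexGaussian s) := by
    rw [hν, ← Measure.map_prod_map _ _ (by fun_prop) (by fun_prop), Measure.map_id, hnoise]
  have hrecv : ∀ t : (Fin 1 → ℂ) × ((Fin k → ℂ) × (Fin 1 → ℂ)),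
      A *ᵥ (V *ᵥ t.1 + Z *ᵥ t.2.1) + t.2.2 =
        fun _ => a * t.1 0 + ((∑ i, (A * Z) 0 i * t.2.1 i) + t.2.2 0) := by
    intro t
    ext i
    rw [Subsingleton.elim i 0, Matrix.mulVec_add, Matrix.mulVec_mulVec, Matrix.mulVec_mulVec]
    simp [Matrix.mulVec, dotProduct, ha, add_assoc]
  have hjoint : ν.map (fun t => (t.1, A *ᵥ (V *ᵥ t.1 + Z *ᵥ t.2.1) + t.2.2)) =
      channelLaw a σu2 s := by
    rw [channelLaw, ← hpair, Measure.map_map (by fun_prop) (by fun_prop)]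
    congr 1
    ext1 t
    rw [hrecv]
    rfl
  have hX : ν.map (fun t => t.1) = gaussianVector 1 σu2 := by
    rw [hν, Measure.map_fst_prod]
    simp
  have hY : ν.map (fun t => A *ᵥ (V *ᵥ t.1 + Z *ᵥ t.2.1) + t.2.2) =
      gaussianVector 1 (‖a‖₊ ^ 2 * σu2 + s) := by
    apply eq_gaussianVector_one
    simp_rw [hrecv]
    rw [Measure.map_map (by fun_prop) (by fun_prop), ← map_output_channel, ← hpair,
      Measure.map_map (by fun_prop) (by fun_prop)]
    rfl
  rw [channelInfo, mutualInfo, hjoint, hX, hY, toReal_klDiv_channelLaw _ _ hs0, hs]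
  push_cast
  rfl

/-! ### Unitary invariance and the distance law of an isotropic vector -/

/-- The squared Euclidean norm of a complex vector. -/
noncomputable def sqNorm {k : ℕ} (x : Fin k → ℂ) : ℝ := ∑ i, ‖x i‖ ^ 2

lemma sqNorm_nonneg {k : ℕ} (x : Fin k → ℂ) : 0 ≤ sqNorm x :=
  Finset.sum_nonneg fun _ _ => by positivity

@[fun_prop]
lemma measurable_sqNorm {k : ℕ} : Measurable (sqNorm (k := k)) := by
  unfold sqNorm; fun_prop

lemma ofReal_sqNorm {k : ℕ} (x : Fin k → ℂ) : (sqNorm x : ℂ) = star x ⬝ᵥ x := by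
  simp [sqNorm, dotProduct, Complex.conj_mul']

lemma sqNorm_mulVec_of_mem_unitaryGroup {k : ℕ} {U : Matrix (Fin k) (Fin k) ℂ}
    (hU : U ∈ Matrix.unitaryGroup (Fin k) ℂ) (x : Fin k → ℂ) : sqNorm (U *ᵥ x) = sqNorm x := by
  have h : (sqNorm (U *ᵥ x) : ℂ) = sqNorm x := by
    rw [ofReal_sqNorm, ofReal_sqNorm, Matrix.star_mulVec, ← Matrix.dotProduct_mulVec,
      Matrix.mulVec_mulVec, ← Matrix.star_eq_conjTranspose, Matrix.mem_unitaryGroup_iff'.1 hU,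
      Matrix.one_mulVec]
  exact_mod_cast h

/-- Puts the real functionals tested by `charFunDual` in the form of real parts of complex linear
forms, whose Gaussian law is known. -/
lemma exists_re_sum_mul_of_strongDual {k : ℕ} (L : StrongDual ℝ (Fin k → ℂ)) :
    ∃ c : Fin k → ℂ, ∀ x, L x = (∑ i, c i * x i).re := by
  refine ⟨fun i => L (Pi.single i 1) - Complex.I * L (Pi.single i Complex.I), fun x => ?_⟩
  have hx : x = ∑ i, ((x i).re • (Pi.single i 1 : Fin k → ℂ) + (x i).im •
      (Pi.single i Complex.I : Fin k → ℂ)) := by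
    ext j
    rw [Finset.sum_apply, Finset.sum_eq_single j]
    · simp
    · intro b _ hb
      simp [Pi.single_eq_of_ne hb.symm]
    · simp
  conv_lhs => rw [hx]
  rw [map_sum, Complex.re_sum]
  refine Finset.sum_congr rfl fun i _ => ?_
  simp [mul_comm]

/-- The law of an i.i.d. complex Gaussian vector is invariant under unitary matrices. -/
lemma map_mulVec_gaussianVector {k : ℕ} (v : ℝ≥0) {U : Matrix (Fin k) (Fin k) ℂ}
    (hU : U ∈ Matrix.unitaryGroup (Fin k) ℂ) :
    (gaussianVector k v).map (fun x => U *ᵥ x) = gaussianVector k v := by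
  have hm : Measurable fun x : Fin k → ℂ => U *ᵥ x := by fun_prop
  have : IsProbabilityMeasure ((gaussianVector k v).map (fun x => U *ᵥ x)) :=
    Measure.isProbabilityMeasure_map hm.aemeasurable
  apply Measure.ext_of_charFunDual
  ext L
  obtain ⟨c, hc⟩ := exists_re_sum_mul_of_strongDual L
  -- The law of a linear form depends only on the norm of its coefficient vector, which `Uᵀ`
  -- preserves.
  have key : ∀ d : Fin k → ℂ, ∫ x, Complex.exp (((∑ i, d i * x i).re : ℝ) * Complex.I)
      ∂gaussianVector k v = ∫ z, Complex.exp ((z.re : ℝ) * Complex.I)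
        ∂complexGaussian (v * ∑ i, ‖d i‖₊ ^ 2) := by
    intro d
    rw [← map_sum_mul_gaussianVector, integral_map (by
      have : Measurable fun x : Fin k → ℂ => ∑ i, d i * x i := by fun_prop
      exact this.aemeasurable) (by fun_prop)]
  rw [charFunDual_apply, charFunDual_apply, integral_map hm.aemeasurable (by fun_prop)]
  simp_rw [hc]
  have h1 : ∀ x : Fin k → ℂ, ∑ i, c i * (U *ᵥ x) i = ∑ i, (Uᵀ *ᵥ c) i * x i := by
    intro x
    change c ⬝ᵥ (U *ᵥ x) = (Uᵀ *ᵥ c) ⬝ᵥ x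
    rw [Matrix.dotProduct_mulVec, Matrix.mulVec_transpose]
  simp_rw [h1]
  rw [key, key]
  have h2 : ∑ i, ‖(Uᵀ *ᵥ c) i‖₊ ^ 2 = ∑ i, ‖c i‖₊ ^ 2 := by
    have := sqNorm_mulVec_of_mem_unitaryGroup (Matrix.transpose_mem_unitaryGroup_iff.2 hU) c
    rw [sqNorm, sqNorm] at this
    apply NNReal.coe_injective
    push_cast
    exact this
  rw [h2]

lemma exists_mem_unitaryGroup_col_eq {n : ℕ} (a : Fin (n + 1) → ℂ) (ha : sqNorm a = 1) :
    ∃ U ∈ Matrix.unitaryGroup (Fin (n + 1)) ℂ, ∀ i, U i 0 = a i := by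
  have hv : Orthonormal ℂ (({0} : Set (Fin (n + 1))).domRestrict
      fun _ : Fin (n + 1) => (WithLp.toLp 2 a : EuclideanSpace ℂ (Fin (n + 1)))) := by
    constructor
    · intro i
      simp only [Set.domRestrict_apply, EuclideanSpace.norm_eq]
      rw [Real.sqrt_eq_one]
      exact ha
    · intro i j hij
      exact absurd (Subsingleton.elim i j) hij
  obtain ⟨b, hb⟩ := hv.exists_orthonormalBasis_extension_of_card_eq (by simp)
  refine ⟨_, (EuclideanSpace.basisFun (Fin (n + 1)) ℂ).toMatrix_orthonormalBasis_mem_unitary b,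
    fun i => ?_⟩
  rw [Module.Basis.toMatrix_apply]
  simp [hb 0 rfl]

lemma lintegral_exp_neg_mul_sqNorm_gaussianVector (k : ℕ) {c : ℝ} (hc : -1 < c) :
    ∫⁻ x, ENNReal.ofReal (Real.exp (-c * sqNorm x)) ∂gaussianVector k 1 =
      ENNReal.ofReal (1 / (1 + c)) ^ k := by
  have h : ∀ x : Fin k → ℂ, ENNReal.ofReal (Real.exp (-c * sqNorm x)) =
      ∏ i, ENNReal.ofReal (Real.exp (-c * ‖x i‖ ^ 2)) := by
    intro x
    rw [← ENNReal.ofReal_prod_of_nonneg (fun _ _ => Real.exp_nonneg _), ← Real.exp_sum, sqNorm,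
      Finset.mul_sum]
  have hind : iIndepFun (fun (i : Fin k) (x : Fin k → ℂ) =>
      ENNReal.ofReal (Real.exp (-c * ‖x i‖ ^ 2))) (gaussianVector k 1) :=
    iIndepFun_pi (X := fun _ (z : ℂ) => ENNReal.ofReal (Real.exp (-c * ‖z‖ ^ 2)))
      fun _ => by fun_prop
  simp_rw [h]
  rw [lintegral_prod_eq_prod_lintegral_of_indepFun _ _ hind fun i => by fun_prop]
  have h1 : ∀ i : Fin k, ∫⁻ x, ENNReal.ofReal (Real.exp (-c * ‖x i‖ ^ 2)) ∂gaussianVector k 1 =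
      ENNReal.ofReal (1 / (1 + c)) := by
    intro i
    rw [← lintegral_exp_neg_mul_sq_norm_complexGaussian hc]
    exact (measurePreserving_eval (fun _ : Fin k => complexGaussian 1) i).lintegral_comp
      (f := fun z => ENNReal.ofReal (Real.exp (-c * ‖z‖ ^ 2))) (by fun_prop)
  simp_rw [h1]
  simp

/-- With `κ = (1 - x) / x` the event is `‖g 0‖² ≥ κ ‖g'‖²`, where `g'` holds the other `n`
coordinates. Given `g'` its probability is `exp (-κ ‖g'‖²)`, and averaging gives `(1 / (1 + κ)) ^ n
= x ^ n`. -/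
lemma gaussianVector_le_sq_norm_head (n : ℕ) {x : ℝ} (hx : 0 < x) (hx1 : x ≤ 1) :
    gaussianVector (n + 1) 1 {g | (1 - x) * sqNorm g ≤ ‖g 0‖ ^ 2} = ENNReal.ofReal x ^ n := by
  have hpres := measurePreserving_piFinSuccAbove (fun _ : Fin (n + 1) => complexGaussian 1) 0
  have hκ : 0 ≤ (1 - x) / x := div_nonneg (by linarith) hx.le
  set S : Set (ℂ × (Fin n → ℂ)) := {p | (1 - x) / x * sqNorm p.2 ≤ ‖p.1‖ ^ 2} with hS
  have hSm : MeasurableSet S := measurableSet_le (by fun_prop) (by fun_prop)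
  have hpre : {g : Fin (n + 1) → ℂ | (1 - x) * sqNorm g ≤ ‖g 0‖ ^ 2} =
      MeasurableEquiv.piFinSuccAbove (fun _ => ℂ) 0 ⁻¹' S := by
    ext g
    have hs : sqNorm g = ‖g 0‖ ^ 2 + sqNorm (fun i : Fin n => g i.succ) := by
      rw [sqNorm, Fin.sum_univ_succ, sqNorm]
    have e : (MeasurableEquiv.piFinSuccAbove (fun _ : Fin (n + 1) => ℂ) 0 g) =
        (g 0, fun i : Fin n => g i.succ) := by
      rfl
    rw [Set.mem_ofPred_eq, Set.mem_preimage, e, hS, Set.mem_ofPred_eq, hs, div_mul_eq_mul_div,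
      div_le_iff₀ hx]
    constructor <;> intro h <;> linarith
  rw [hpre, gaussianVector, hpres.measure_preimage hSm.nullMeasurableSet,
    Measure.prod_apply_symm hSm]
  have h1 : ∀ y : Fin n → ℂ, complexGaussian 1 ((fun z => (z, y)) ⁻¹' S) =
      ENNReal.ofReal (Real.exp (-((1 - x) / x) * sqNorm y)) := by
    intro y
    rw [neg_mul]
    exact complexGaussian_one_le_sq_norm (mul_nonneg hκ (sqNorm_nonneg y))
  simp_rw [h1]
  have := lintegral_exp_neg_mul_sqNorm_gaussianVector n (c := (1 - x) / x) (by linarith)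
  rw [gaussianVector] at this
  refine this.trans ?_
  congr 2
  field_simp
  ring

lemma gaussianVector_le_sq_norm_dotProduct (n : ℕ) {x : ℝ} (hx : 0 < x) (hx1 : x ≤ 1)
    {a : Fin (n + 1) → ℂ} (ha : sqNorm a = 1) :
    gaussianVector (n + 1) 1 {g | (1 - x) * sqNorm g ≤ ‖∑ i, g i * a i‖ ^ 2} =
      ENNReal.ofReal x ^ n := by
  obtain ⟨U, hU, hUa⟩ := exists_mem_unitaryGroup_col_eq a ha
  have hUt := Matrix.transpose_mem_unitaryGroup_iff.2 hU
  have hms : MeasurableSet {g : Fin (n + 1) → ℂ | (1 - x) * sqNorm g ≤ ‖g 0‖ ^ 2} :=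
    measurableSet_le (by fun_prop) (by fun_prop)
  rw [← gaussianVector_le_sq_norm_head n hx hx1]
  conv_rhs => rw [← map_mulVec_gaussianVector 1 hUt]
  rw [Measure.map_apply (by fun_prop) hms]
  congr 1
  ext g
  rw [Set.mem_preimage, Set.mem_ofPred_eq, Set.mem_ofPred_eq,
    sqNorm_mulVec_of_mem_unitaryGroup hUt]
  have : (Uᵀ *ᵥ g) 0 = ∑ i, g i * a i := by
    simp [Matrix.mulVec, dotProduct, hUa, mul_comm]
  rw [this]

lemma measurable_matrix_apply {m n : ℕ} (i : Fin m) (j : Fin n) :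
    Measurable fun W : Matrix (Fin m) (Fin n) ℂ => W i j :=
  (measurable_pi_apply (X := fun _ : Fin n => ℂ) j).comp
    (measurable_pi_apply (X := fun _ : Fin m => Fin n → ℂ) i)

lemma measurable_matrix_mul_left {m n k : ℕ} (U : Matrix (Fin m) (Fin n) ℂ) :
    Measurable fun W : Matrix (Fin n) (Fin k) ℂ => U * W := by
  refine measurable_pi_lambda _ fun i => measurable_pi_lambda _ fun j => ?_
  simp only [Matrix.mul_apply]
  exact Finset.measurable_sum _ fun l _ => (measurable_matrix_apply l j).const_mul _

/-- Invariance is applied to the adjoint of a unitary whose first column is the conjugate of `g`,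
normalized: it carries the form `g` to `√(sqNorm g)` times the first coordinate. -/
lemma IsIsotropicUnitary.measure_le_sq_norm_dotProduct {n : ℕ}
    {ν : Measure (Matrix (Fin (n + 1)) (Fin 1) ℂ)} (hν : IsIsotropicUnitary ν) (t : ℝ)
    {g : Fin (n + 1) → ℂ} (hg : 0 < sqNorm g) :
    ν {W | t * sqNorm g ≤ ‖∑ i, g i * W i 0‖ ^ 2} = ν {W | t ≤ ‖W 0 0‖ ^ 2} := by
  have hs : 0 < √(sqNorm g) := Real.sqrt_pos.2 hg
  obtain ⟨U, hU, hUa⟩ := exists_mem_unitaryGroup_col_eq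
    (fun i => starRingEnd ℂ (g i) / (√(sqNorm g) : ℂ)) (by
      simp only [sqNorm, norm_div, RCLike.norm_conj, div_pow, ← Finset.sum_div]
      rw [Complex.norm_real, Real.norm_of_nonneg (Real.sqrt_nonneg _),
        Real.sq_sqrt (by exact hg.le)]
      exact div_self hg.ne')
  have hUs : star U ∈ Matrix.unitaryGroup (Fin (n + 1)) ℂ := Unitary.star_mem hU
  have hms : MeasurableSet {W : Matrix (Fin (n + 1)) (Fin 1) ℂ | t ≤ ‖W 0 0‖ ^ 2} :=
    measurableSet_le measurable_const ((measurable_matrix_apply 0 0).norm.pow_const 2)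
  conv_rhs => rw [← hν.invariant _ hUs]
  rw [Measure.map_apply (measurable_matrix_mul_left _) hms]
  congr 1
  ext W
  have h1 : (star U * W) 0 0 = (∑ i, g i * W i 0) / (√(sqNorm g) : ℂ) := by
    rw [Matrix.mul_apply, Finset.sum_div]
    refine Finset.sum_congr rfl fun i _ => ?_
    rw [Matrix.star_apply, hUa]
    simp only [star_div₀, RCLike.star_def, Complex.conj_conj, Complex.conj_ofReal]
    ring
  rw [Set.mem_preimage, Set.mem_ofPred_eq, Set.mem_ofPred_eq, h1, norm_div, div_pow,
    Complex.norm_real, Real.norm_of_nonneg (Real.sqrt_nonneg _), Real.sq_sqrt hg.le,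
    le_div_iff₀ hg]

lemma sqNorm_col_of_orthonormal {n : ℕ} {W : Matrix (Fin n) (Fin 1) ℂ} (hW : Wᴴ * W = 1) :
    sqNorm (fun i => W i 0) = 1 := by
  have h : (Wᴴ * W) 0 0 = 1 := by rw [hW]; simp
  have h2 : ((sqNorm fun i => W i 0 : ℝ) : ℂ) = 1 := by
    rw [ofReal_sqNorm, ← h, Matrix.mul_apply]
    rfl
  exact_mod_cast h2

lemma complexGaussian_one_singleton_zero : complexGaussian 1 {0} = 0 := by
  rw [complexGaussian_eq_withDensity one_ne_zero]
  exact withDensity_absolutelyContinuous _ _ (measure_singleton _)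

lemma ae_sqNorm_pos_gaussianVector (n : ℕ) : ∀ᵐ g ∂gaussianVector (n + 1) 1, 0 < sqNorm g := by
  have h0 : ∀ᵐ z ∂complexGaussian 1, z ≠ 0 := by
    rw [ae_iff]
    simpa using complexGaussian_one_singleton_zero
  have h1 : ∀ᵐ g ∂gaussianVector (n + 1) 1, g 0 ≠ 0 :=
    (measurePreserving_eval (fun _ : Fin (n + 1) => complexGaussian 1) 0).quasiMeasurePreserving.ae
      h0
  filter_upwards [h1] with g hg
  have : 0 < ‖g 0‖ ^ 2 := by positivity
  exact this.trans_le (Finset.single_le_sum (f := fun i => ‖g i‖ ^ 2)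
    (fun _ _ => by positivity) (Finset.mem_univ 0))

/-- The distribution of the quantization error of an isotropic unit vector. -/
lemma IsIsotropicUnitary.measure_one_sub_mul_sqNorm_le {n : ℕ}
    {ν : Measure (Matrix (Fin (n + 1)) (Fin 1) ℂ)} (hν : IsIsotropicUnitary ν)
    {x : ℝ} (hx : 0 < x) (hx1 : x ≤ 1) {g : Fin (n + 1) → ℂ} (hg : 0 < sqNorm g) :
    ν {W | (1 - x) * sqNorm g ≤ ‖∑ i, g i * W i 0‖ ^ 2} = ENNReal.ofReal x ^ n := by
  have := hν.isProb
  rw [hν.measure_le_sq_norm_dotProduct _ hg]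
  -- The event is averaged over a Gaussian `g` independent of `W` and computed twice by Fubini. For
  -- fixed `g` the probability does not depend on `g`; for fixed `W` it is the Gaussian computation.
  -- No explicit description of Haar measure is needed.
  set S : Set ((Fin (n + 1) → ℂ) × Matrix (Fin (n + 1)) (Fin 1) ℂ) :=
    {p | (1 - x) * sqNorm p.1 ≤ ‖∑ i, p.1 i * p.2 i 0‖ ^ 2} with hS
  have hSm : MeasurableSet S := by
    refine measurableSet_le (by fun_prop) (Measurable.pow_const (Measurable.norm ?_) 2)
    exact Finset.measurable_sum _ fun i _ =>
      (by fun_prop : Measurable fun p : (Fin (n + 1) → ℂ) × Matrix (Fin (n + 1)) (Fin 1) ℂ =>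
        p.1 i).mul ((measurable_matrix_apply i 0).comp measurable_snd)
  have h1 : (gaussianVector (n + 1) 1).prod ν S = ν {W | 1 - x ≤ ‖W 0 0‖ ^ 2} := by
    rw [Measure.prod_apply hSm]
    have : ∀ᵐ g ∂gaussianVector (n + 1) 1, ν (Prod.mk g ⁻¹' S) = ν {W | 1 - x ≤ ‖W 0 0‖ ^ 2} := by
      filter_upwards [ae_sqNorm_pos_gaussianVector n] with g hg
      exact hν.measure_le_sq_norm_dotProduct _ hg
    rw [lintegral_congr_ae this]
    simp
  have h2 : (gaussianVector (n + 1) 1).prod ν S = ENNReal.ofReal x ^ n := by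
    rw [Measure.prod_apply_symm hSm]
    have : ∀ᵐ W ∂ν, gaussianVector (n + 1) 1 ((fun g => (g, W)) ⁻¹' S) =
        ENNReal.ofReal x ^ n := by
      filter_upwards [hν.orthonormal] with W hW
      exact gaussianVector_le_sq_norm_dotProduct n hx hx1 (sqNorm_col_of_orthonormal hW)
    rw [lintegral_congr_ae this]
    simp
  rw [← h1, h2]

/-! ### Probability bounds at a fixed number of antennas -/

/-- Chernoff bounds for both tails of the squared norm of a complex Gaussian vector. -/
lemma gaussianVector_sqNorm_tail_le (k : ℕ) {a : ℝ} (ha : 0 < a) :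
    gaussianVector k 1 {g | (1 - a) * sqNorm g ≤ (1 - a) * (a * k)} ≤
      ENNReal.ofReal ((a * Real.exp (1 - a)) ^ k) := by
  -- `1 / a - 1` is the optimal Chernoff parameter. Its sign is that of `1 - a`, so one computation
  -- covers the lower tail (`a < 1`) and the upper tail (`a > 1`).
  have hc : -1 < 1 / a - 1 := by
    have : 0 < 1 / a := by positivity
    linarith
  have hsub : {g : Fin k → ℂ | (1 - a) * sqNorm g ≤ (1 - a) * (a * k)} ⊆
      {g | ENNReal.ofReal (Real.exp (-(1 - a) * k)) ≤
        ENNReal.ofReal (Real.exp (-(1 / a - 1) * sqNorm g))} := by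
    intro g hg
    rw [Set.mem_ofPred_eq] at hg
    refine ENNReal.ofReal_le_ofReal (Real.exp_le_exp.2 ?_)
    have h1 : 1 / a - 1 = (1 - a) / a := by field_simp
    have h2 : (1 - a) * sqNorm g / a ≤ (1 - a) * k := by
      rw [div_le_iff₀ ha]
      refine hg.trans (le_of_eq ?_)
      ring
    rw [h1]
    have h3 : -((1 - a) / a) * sqNorm g = -((1 - a) * sqNorm g / a) := by ring
    rw [h3]
    linarith
  have hmarkov := mul_meas_ge_le_lintegral (μ := gaussianVector k 1)
    (f := fun g => ENNReal.ofReal (Real.exp (-(1 / a - 1) * sqNorm g))) (by fun_prop)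
    (ENNReal.ofReal (Real.exp (-(1 - a) * k)))
  rw [lintegral_exp_neg_mul_sqNorm_gaussianVector k hc] at hmarkov
  have e1 : 1 / (1 + (1 / a - 1)) = a := by field_simp; ring
  rw [e1, ← ENNReal.ofReal_pow ha.le] at hmarkov
  refine (measure_mono hsub).trans ?_
  have hpos : 0 < Real.exp (-(1 - a) * k) := Real.exp_pos _
  rw [mul_comm, ← ENNReal.le_div_iff_mul_le (by simp [Real.exp_pos]) (by simp),
    ← ENNReal.ofReal_div_of_pos hpos] at hmarkov
  refine hmarkov.trans (le_of_eq ?_)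
  congr 1
  rw [mul_pow, ← Real.exp_nat_mul, neg_mul, Real.exp_neg, div_inv_eq_mul, mul_comm (1 - a)]

/-- The linear form has the law of `‖c‖ z` with `z` standard. The strict inequality makes the event
empty when `c = 0`. -/
lemma gaussianVector_lt_sq_norm_dotProduct_le (k : ℕ) (t : ℝ) (c : Fin k → ℂ) :
    gaussianVector k 1 {g | t * sqNorm c < ‖∑ i, g i * c i‖ ^ 2} ≤
      ENNReal.ofReal (Real.exp (-t)) := by
  rcases lt_or_ge t 0 with ht | ht
  · refine prob_le_one.trans (ENNReal.one_le_ofReal.2 (Real.one_le_exp ?_))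
    linarith
  have hlaw : (gaussianVector k 1).map (fun g => ∑ i, g i * c i) =
      (complexGaussian 1).map (fun z => (√(sqNorm c) : ℂ) * z) := by
    rw [map_mul_complexGaussian]
    have := map_sum_mul_gaussianVector 1 c
    simp_rw [mul_comm (c _)] at this
    rw [this, one_mul, mul_one]
    congr 1
    apply NNReal.coe_injective
    push_cast
    rw [Complex.norm_real, Real.norm_of_nonneg (Real.sqrt_nonneg _), Real.sq_sqrt (sqNorm_nonneg c)]
    rfl
  have hm : MeasurableSet {z : ℂ | t * sqNorm c < ‖z‖ ^ 2} :=
    measurableSet_lt (by fun_prop) (by fun_prop)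
  have h1 : gaussianVector k 1 {g | t * sqNorm c < ‖∑ i, g i * c i‖ ^ 2} =
      (gaussianVector k 1).map (fun g => ∑ i, g i * c i) {z : ℂ | t * sqNorm c < ‖z‖ ^ 2} := by
    rw [Measure.map_apply (by fun_prop) hm]
    rfl
  rw [h1, hlaw, Measure.map_apply (by fun_prop) hm, ← complexGaussian_one_le_sq_norm ht]
  refine measure_mono fun z hz => ?_
  rw [Set.mem_preimage, Set.mem_ofPred_eq, norm_mul, mul_pow, Complex.norm_real,
    Real.norm_of_nonneg (Real.sqrt_nonneg _), Real.sq_sqrt (sqNorm_nonneg c), mul_comm] at hz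
  rw [Set.mem_ofPred_eq]
  exact (lt_of_mul_lt_mul_left hz (sqNorm_nonneg c)).le

lemma measure_pair_mem_eq_lintegral {Ω α β : Type*} [MeasurableSpace Ω] [MeasurableSpace α]
    [MeasurableSpace β] {μ : Measure Ω} [IsProbabilityMeasure μ] {X : Ω → α} {Y : Ω → β}
    (hX : AEMeasurable X μ) (hY : AEMeasurable Y μ) (hXY : IndepFun X Y μ) {S : Set (α × β)}
    (hS : MeasurableSet S) :
    μ {ω | (X ω, Y ω) ∈ S} = ∫⁻ x, μ.map Y (Prod.mk x ⁻¹' S) ∂μ.map X := by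
  have := Measure.isProbabilityMeasure_map hX
  have := Measure.isProbabilityMeasure_map hY
  rw [← Measure.prod_apply hS, ← (indepFun_iff_map_prod_eq_prod_map_map hX hY).1 hXY,
    Measure.map_apply_of_aemeasurable (hX.prodMk hY) hS]
  rfl

section

variable {Ω : Type*} [MeasurableSpace Ω] {μ : Measure Ω} [IsProbabilityMeasure μ] {N : ℕ}
  {h g : Ω → Fin N → ℂ}

lemma measure_lt_sq_norm_inner_le (hh : HasLaw h (gaussianVector N 1) μ)
    (hg : HasLaw g (gaussianVector N 1) μ) (hhg : IndepFun h g μ) (t : ℝ) :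
    μ {ω | t * sqNorm (h ω) < ‖∑ i, g ω i * star (h ω i)‖ ^ 2} ≤
      ENNReal.ofReal (Real.exp (-t)) := by
  set S : Set ((Fin N → ℂ) × (Fin N → ℂ)) :=
    {p | t * sqNorm p.1 < ‖∑ i, p.2 i * star (p.1 i)‖ ^ 2} with hS
  have hSm : MeasurableSet S := measurableSet_lt (by fun_prop) (by fun_prop)
  have := measure_pair_mem_eq_lintegral hh.aemeasurable hg.aemeasurable hhg hSm
  refine this.le.trans ?_
  rw [hh.map_eq, hg.map_eq]
  calc ∫⁻ x, gaussianVector N 1 (Prod.mk x ⁻¹' S) ∂gaussianVector N 1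
      ≤ ∫⁻ x, ENNReal.ofReal (Real.exp (-t)) ∂gaussianVector N 1 := by
        refine lintegral_mono fun x => ?_
        have h1 := gaussianVector_lt_sq_norm_dotProduct_le N t (fun i => star (x i))
        have h2 : sqNorm (fun i => star (x i)) = sqNorm x := by simp [sqNorm]
        rwa [h2] at h1
    _ = _ := by simp

/-- The codewords within a given distance of the channel direction, and received by the
eavesdropper with large power, are rare. -/
lemma measure_near_and_lt_sq_norm_le {W : Ω → Matrix (Fin N) (Fin 1) ℂ} (hN : 0 < N)
    (hh : HasLaw h (gaussianVector N 1) μ)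
    (hg : HasLaw g (gaussianVector N 1) μ) (hhg : IndepFun h g μ) (hW : AEMeasurable W μ)
    (hWlaw : IsIsotropicUnitary (μ.map W)) (hhgW : IndepFun (fun ω => (h ω, g ω)) W μ)
    {x : ℝ} (hx : 0 < x) (hx1 : x ≤ 1) (t : ℝ) :
    μ {ω | (1 - x) * sqNorm (h ω) ≤ ‖∑ i, h ω i * W ω i 0‖ ^ 2 ∧
        t < ‖∑ i, g ω i * W ω i 0‖ ^ 2} ≤
      ENNReal.ofReal (x ^ (N - 1) * Real.exp (-t)) := by
  obtain ⟨n, rfl⟩ : ∃ n, N = n + 1 := ⟨N - 1, by omega⟩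
  have hprob := hWlaw.isProb
  set S : Set (Matrix (Fin (n + 1)) (Fin 1) ℂ × ((Fin (n + 1) → ℂ) × (Fin (n + 1) → ℂ))) :=
    {p | (1 - x) * sqNorm p.2.1 ≤ ‖∑ i, p.2.1 i * p.1 i 0‖ ^ 2 ∧
      t < ‖∑ i, p.2.2 i * p.1 i 0‖ ^ 2} with hS
  have hsum : ∀ f : (Matrix (Fin (n + 1)) (Fin 1) ℂ × ((Fin (n + 1) → ℂ) × (Fin (n + 1) → ℂ))) →
      (Fin (n + 1) → ℂ), Measurable f → Measurable fun p => ‖∑ i, f p i * p.1 i 0‖ ^ 2 :=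
    fun f hf => (Finset.measurable_sum _ fun i _ => (measurable_pi_iff.1 hf i).mul
      ((measurable_matrix_apply i 0).comp measurable_fst)).norm.pow_const 2
  have hSm : MeasurableSet S := by
    refine (measurableSet_le (by fun_prop) (hsum _ (by fun_prop))).inter
      (measurableSet_lt measurable_const (hsum _ (by fun_prop)))
  have := measure_pair_mem_eq_lintegral hW (hh.aemeasurable.prodMk hg.aemeasurable) hhgW.symm hSm
  refine this.le.trans ?_
  rw [(indepFun_iff_map_prod_eq_prod_map_map hh.aemeasurable hg.aemeasurable).1 hhg, hh.map_eq,
    hg.map_eq]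
  -- For a fixed codeword the two conditions concern `h` and `g` separately, so the probability
  -- factors.
  have hae : ∀ᵐ w ∂μ.map W, (gaussianVector (n + 1) 1).prod (gaussianVector (n + 1) 1)
      (Prod.mk w ⁻¹' S) ≤ ENNReal.ofReal (x ^ n * Real.exp (-t)) := by
    filter_upwards [hWlaw.orthonormal] with w hw
    have hw1 := sqNorm_col_of_orthonormal hw
    have hrect : Prod.mk w ⁻¹' S =
        {y : Fin (n + 1) → ℂ | (1 - x) * sqNorm y ≤ ‖∑ i, y i * w i 0‖ ^ 2} ×ˢ
          {y | t < ‖∑ i, y i * w i 0‖ ^ 2} := rfl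
    rw [hrect, Measure.prod_prod, gaussianVector_le_sq_norm_dotProduct n hx hx1 hw1,
      ENNReal.ofReal_mul (by positivity), ENNReal.ofReal_pow hx.le]
    have h2 := gaussianVector_lt_sq_norm_dotProduct_le (n + 1) t (fun i => w i 0)
    rw [hw1, mul_one] at h2
    gcongr
  refine (lintegral_mono_ae hae).trans ?_
  simp

/-- Once `h` is fixed, the codewords miss its `x`-neighbourhood independently, each with probability
`1 - x ^ (N - 1)`. -/
lemma measure_forall_far_le {ι : Type*} [Fintype ι] {C : ι → Ω → Matrix (Fin N) (Fin 1) ℂ}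
    (hN : 0 < N) (hh : HasLaw h (gaussianVector N 1) μ) (hC : ∀ i, AEMeasurable (C i) μ)
    (hClaw : ∀ i, IsIsotropicUnitary (μ.map (C i))) (hCindep : iIndepFun C μ)
    (hhC : IndepFun h (fun ω i => C i ω) μ) {x : ℝ} (hx : 0 < x) (hx1 : x ≤ 1) :
    μ {ω | ∀ i, ‖∑ k, h ω k * C i ω k 0‖ ^ 2 < (1 - x) * sqNorm (h ω)} ≤
      ENNReal.ofReal ((1 - x ^ (N - 1)) ^ Fintype.card ι) := by
  obtain ⟨n, rfl⟩ : ∃ n, N = n + 1 := ⟨N - 1, by omega⟩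
  have hprob : ∀ i, IsProbabilityMeasure (μ.map (C i)) := fun i => (hClaw i).isProb
  set S : Set ((Fin (n + 1) → ℂ) × (ι → Matrix (Fin (n + 1)) (Fin 1) ℂ)) :=
    {p | ∀ i, ‖∑ k, p.1 k * p.2 i k 0‖ ^ 2 < (1 - x) * sqNorm p.1} with hS
  have hSm : MeasurableSet S := by
    rw [hS, Set.ofPred_forall]
    refine MeasurableSet.iInter fun i => measurableSet_lt ?_ (by fun_prop)
    exact (Finset.measurable_sum _ fun k _ => (by fun_prop : Measurable fun p : (Fin (n + 1) → ℂ) ×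
      (ι → Matrix (Fin (n + 1)) (Fin 1) ℂ) => p.1 k).mul
      ((measurable_matrix_apply k 0).comp (by fun_prop))).norm.pow_const 2
  have := measure_pair_mem_eq_lintegral hh.aemeasurable (aemeasurable_pi_lambda _ hC) hhC hSm
  refine this.le.trans ?_
  rw [(iIndepFun_iff_map_fun_eq_pi_map hC).1 hCindep, hh.map_eq]
  have hae : ∀ᵐ y ∂gaussianVector (n + 1) 1, (Measure.pi fun i => μ.map (C i))
      (Prod.mk y ⁻¹' S) ≤ ENNReal.ofReal ((1 - x ^ n) ^ Fintype.card ι) := by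
    filter_upwards [ae_sqNorm_pos_gaussianVector n] with y hy
    have hrect : Prod.mk y ⁻¹' S = Set.univ.pi fun _ : ι =>
        {w : Matrix (Fin (n + 1)) (Fin 1) ℂ |
          (1 - x) * sqNorm y ≤ ‖∑ k, y k * w k 0‖ ^ 2}ᶜ := by
      ext p
      simp [hS]
    have hms : MeasurableSet {w : Matrix (Fin (n + 1)) (Fin 1) ℂ |
          (1 - x) * sqNorm y ≤ ‖∑ k, y k * w k 0‖ ^ 2} :=
      measurableSet_le measurable_const ((Finset.measurable_sum _ fun k _ =>
        (measurable_matrix_apply k 0).const_mul _).norm.pow_const 2)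
    rw [hrect, Measure.pi_pi]
    have h1 : ∀ i, μ.map (C i) {w : Matrix (Fin (n + 1)) (Fin 1) ℂ |
          (1 - x) * sqNorm y ≤ ‖∑ k, y k * w k 0‖ ^ 2}ᶜ = ENNReal.ofReal (1 - x ^ n) := by
      intro i
      rw [prob_compl_eq_one_sub hms, (hClaw i).measure_one_sub_mul_sqNorm_le hx hx1 hy,
        ← ENNReal.ofReal_pow hx.le, ENNReal.ofReal_sub _ (by positivity), ENNReal.ofReal_one]
    simp_rw [h1]
    rw [Finset.prod_const, Finset.card_univ,
      ENNReal.ofReal_pow (sub_nonneg.2 (pow_le_one₀ hx.le hx1))]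
  refine (lintegral_mono_ae hae).trans ?_
  simp

end

/-! ### Algebra of unitary precoders -/

section Precoder

variable {n k : ℕ} {V : Matrix (Fin n) (Fin 1) ℂ} {Z : Matrix (Fin n) (Fin k) ℂ}

lemma mul_conjTranspose_apply_zero {l : ℕ} (A : Matrix (Fin 1) (Fin l) ℂ) :
    (A * Aᴴ) 0 0 = (sqNorm (A 0) : ℂ) := by
  rw [ofReal_sqNorm, dotProduct_comm, Matrix.mul_apply]
  rfl

lemma IsUnitaryPrecoder.add_eq_one (h : IsUnitaryPrecoder V Z) : V * Vᴴ + Z * Zᴴ = 1 := by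
  have := h.2
  rwa [Matrix.conjTranspose_fromCols_eq_fromRows_conjTranspose,
    Matrix.fromCols_mul_fromRows] at this

/-- Pythagoras for `VVᴴ + ZZᴴ = 1`. It removes `Z` from the rates, so the choice of completion is
irrelevant. -/
lemma IsUnitaryPrecoder.sqNorm_add (h : IsUnitaryPrecoder V Z) (A : Matrix (Fin 1) (Fin n) ℂ) :
    ‖(A * V) 0 0‖ ^ 2 + ∑ i, ‖(A * Z) 0 i‖ ^ 2 = sqNorm (A 0) := by
  have h1 : A * Aᴴ = (A * V) * (A * V)ᴴ + (A * Z) * (A * Z)ᴴ := by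
    rw [Matrix.conjTranspose_mul, Matrix.conjTranspose_mul, Matrix.mul_assoc, Matrix.mul_assoc,
      ← Matrix.mul_assoc V, ← Matrix.mul_assoc Z, ← Matrix.mul_add, ← Matrix.add_mul,
      h.add_eq_one, Matrix.one_mul]
  have h2 := congrFun (congrFun h1 0) 0
  rw [Matrix.add_apply, mul_conjTranspose_apply_zero, mul_conjTranspose_apply_zero,
    mul_conjTranspose_apply_zero] at h2
  have h3 : sqNorm (A 0) = sqNorm ((A * V) 0) + sqNorm ((A * Z) 0) := by exact_mod_cast h2
  rw [h3]
  simp [sqNorm]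

variable {H : Matrix (Fin 1) (Fin n) ℂ}

/-- When `H ≠ 0`, this forces `V` to be the normalized `Hᴴ` up to a phase; gains and distances
relative to `V` thus become expressions in `H`. -/
lemma IsUnitaryPrecoder.eq_mul_of_mul_eq_zero (h : IsUnitaryPrecoder V Z) (hZ : H * Z = 0) :
    H = H * V * Vᴴ := by
  conv_lhs => rw [← Matrix.mul_one H, ← h.add_eq_one, Matrix.mul_add, ← Matrix.mul_assoc,
    ← Matrix.mul_assoc, hZ, Matrix.zero_mul, add_zero]

lemma IsUnitaryPrecoder.sq_norm_mul_eq (h : IsUnitaryPrecoder V Z) (hZ : H * Z = 0) :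
    ‖(H * V) 0 0‖ ^ 2 = sqNorm (H 0) := by
  rw [← h.sqNorm_add, hZ]
  simp

lemma IsUnitaryPrecoder.sq_norm_mul_mul_sqNorm (h : IsUnitaryPrecoder V Z) (hZ : H * Z = 0)
    (G : Matrix (Fin 1) (Fin n) ℂ) :
    ‖(G * V) 0 0‖ ^ 2 * sqNorm (H 0) = ‖∑ i, G 0 i * star (H 0 i)‖ ^ 2 := by
  have h1 : G * Hᴴ = (G * V) * (H * V)ᴴ := by
    conv_lhs => rw [h.eq_mul_of_mul_eq_zero hZ]
    rw [Matrix.conjTranspose_mul (H * V), Matrix.conjTranspose_conjTranspose, Matrix.mul_assoc]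
  have h2 : ∑ i, G 0 i * star (H 0 i) = (G * V) 0 0 * star ((H * V) 0 0) := by
    have := congrFun (congrFun h1 0) 0
    rw [Matrix.mul_apply, Matrix.mul_apply] at this
    simpa using this
  rw [h2, norm_mul, norm_star, mul_pow, h.sq_norm_mul_eq hZ]

lemma IsUnitaryPrecoder.chordalDist_eq (h : IsUnitaryPrecoder V Z) (hZ : H * Z = 0)
    (hH : 0 < sqNorm (H 0)) (W : Matrix (Fin n) (Fin 1) ℂ) :
    chordalDist W V = 1 - ‖∑ i, H 0 i * W i 0‖ ^ 2 / sqNorm (H 0) := by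
  have h1 : ‖∑ i, H 0 i * W i 0‖ ^ 2 = sqNorm (H 0) * ‖(Vᴴ * W) 0 0‖ ^ 2 := by
    have h2 : (H * W) 0 0 = (H * V) 0 0 * (Vᴴ * W) 0 0 := by
      conv_lhs => rw [h.eq_mul_of_mul_eq_zero hZ, Matrix.mul_assoc, Matrix.mul_apply]
      simp
    rw [← Matrix.mul_apply, h2, norm_mul, mul_pow, h.sq_norm_mul_eq hZ]
  have h3 : (Matrix.trace (Vᴴ * W * Wᴴ * V)).re = ‖(Vᴴ * W) 0 0‖ ^ 2 := by
    have e : Vᴴ * W * Wᴴ * V = (Vᴴ * W) * (Vᴴ * W)ᴴ := by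
      rw [Matrix.conjTranspose_mul, Matrix.conjTranspose_conjTranspose, Matrix.mul_assoc _ Wᴴ]
    rw [e, Matrix.trace_fin_one, mul_conjTranspose_apply_zero]
    simp [sqNorm, -Complex.ofReal_pow]
  rw [chordalDist, h3, h1, mul_div_cancel_left₀ _ hH.ne', Nat.cast_one]

end Precoder

lemma sq_norm_sum_mul_le {n : ℕ} (h : Fin n → ℂ) {W : Matrix (Fin n) (Fin 1) ℂ}
    (hW : Wᴴ * W = 1) : ‖∑ i, h i * W i 0‖ ^ 2 ≤ sqNorm h := by
  calc ‖∑ i, h i * W i 0‖ ^ 2 ≤ (∑ i, ‖h i‖ * ‖W i 0‖) ^ 2 := by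
        gcongr
        refine (norm_sum_le _ _).trans (le_of_eq ?_)
        simp
    _ ≤ sqNorm h * sqNorm (fun i => W i 0) := Finset.sum_mul_sq_le_sq_mul_sq _ _ _
    _ = sqNorm h := by rw [sqNorm_col_of_orthonormal hW, mul_one]

/-! ### Almost sure limits from summable tail bounds -/

section AlmostSure

variable {Ω : Type*} [MeasurableSpace Ω] {μ : Measure Ω}

/-- Borel–Cantelli, which holds for outer measure and so needs no measurability of the events. Small
`N`, where no law is assumed, are discarded. -/
lemma ae_eventually_of_measure_le {p : ℕ → Ω → Prop} {f : ℕ → ℝ} (hf : Summable f)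
    (hle : ∀ᶠ N in atTop, μ {ω | ¬ p N ω} ≤ ENNReal.ofReal (f N)) :
    ∀ᵐ ω ∂μ, ∀ᶠ N in atTop, p N ω := by
  obtain ⟨N₀, hN₀⟩ := eventually_atTop.1 hle
  have hs : ∑' N, μ {ω | N₀ ≤ N ∧ ¬ p N ω} ≠ ⊤ := by
    refine ne_top_of_le_ne_top hf.tsum_ofReal_ne_top (ENNReal.tsum_le_tsum fun N => ?_)
    by_cases h : N₀ ≤ N
    · simpa [h] using hN₀ N h
    · simp [h]
  filter_upwards [ae_eventually_notMem hs] with ω hω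
  filter_upwards [hω, eventually_ge_atTop N₀] with N h1 h2
  by_contra h3
  exact h1 ⟨h2, h3⟩

/-- Rational thresholds suffice, so only countably many null sets are collected. -/
lemma ae_tendsto_of_forall_lt_gt {X : ℕ → Ω → ℝ} {l : ℝ}
    (h1 : ∀ a < l, ∀ᵐ ω ∂μ, ∀ᶠ N in atTop, a < X N ω)
    (h2 : ∀ a > l, ∀ᵐ ω ∂μ, ∀ᶠ N in atTop, X N ω < a) :
    ∀ᵐ ω ∂μ, Tendsto (fun N => X N ω) atTop (𝓝 l) := by
  have h1' : ∀ᵐ ω ∂μ, ∀ q : ℚ, (q : ℝ) < l → ∀ᶠ N in atTop, (q : ℝ) < X N ω :=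
    ae_all_iff.2 fun q => by
      by_cases h : (q : ℝ) < l
      · filter_upwards [h1 q h] with ω hω _ using hω
      · exact ae_of_all _ fun _ h' => absurd h' h
  have h2' : ∀ᵐ ω ∂μ, ∀ q : ℚ, l < (q : ℝ) → ∀ᶠ N in atTop, X N ω < (q : ℝ) :=
    ae_all_iff.2 fun q => by
      by_cases h : l < (q : ℝ)
      · filter_upwards [h2 q h] with ω hω _ using hω
      · exact ae_of_all _ fun _ h' => absurd h' h
  filter_upwards [h1', h2'] with ω hω1 hω2
  refine tendsto_order.2 ⟨fun a ha => ?_, fun a ha => ?_⟩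
  · obtain ⟨q, hq1, hq2⟩ := exists_rat_btwn ha
    exact (hω1 q hq2).mono fun N hN => hq1.trans hN
  · obtain ⟨q, hq1, hq2⟩ := exists_rat_btwn ha
    exact (hω2 q hq1).mono fun N hN => hN.trans hq2

lemma summable_exp_of_tendsto_div {u : ℕ → ℝ} {L : ℝ} (hL : L < 0)
    (h : Tendsto (fun N : ℕ => u N / N) atTop (𝓝 L)) : Summable fun N => Real.exp (u N) := by
  have hr : Real.exp (L / 2) < 1 := by
    rw [← Real.exp_zero]
    exact Real.exp_lt_exp.2 (by linarith)
  refine Summable.of_norm_bounded_eventually_nat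
    (summable_geometric_of_lt_one (Real.exp_nonneg (L / 2)) hr) ?_
  filter_upwards [h.eventually_lt_const (by linarith : L < L / 2), eventually_gt_atTop 0]
    with N hN hN0
  have hN0' : (0 : ℝ) < N := by exact_mod_cast hN0
  rw [Real.norm_of_nonneg (Real.exp_nonneg _), ← Real.exp_nat_mul]
  rw [div_lt_iff₀ hN0'] at hN
  exact Real.exp_le_exp.2 (by linarith)

/-- Strong law of large numbers for the squared norms of complex Gaussian vectors of growing
length, with arbitrary dependence between the different lengths. -/
lemma ae_tendsto_sqNorm_div {h : (N : ℕ) → Ω → Fin N → ℂ}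
    (hh : ∀ N, 1 < N → HasLaw (h N) (gaussianVector N 1) μ) :
    ∀ᵐ ω ∂μ, Tendsto (fun N : ℕ => sqNorm (h N ω) / N) atTop (𝓝 1) := by
  have key : ∀ a : ℝ, 0 < a → a ≠ 1 →
      ∀ᵐ ω ∂μ, ∀ᶠ N : ℕ in atTop, (1 - a) * (a * N) < (1 - a) * sqNorm (h N ω) := by
    intro a ha ha1
    have hr : a * Real.exp (1 - a) < 1 := by
      have h1 : a < Real.exp (a - 1) := by
        have := Real.add_one_lt_exp (sub_ne_zero.2 ha1)
        linarith
      calc a * Real.exp (1 - a) < Real.exp (a - 1) * Real.exp (1 - a) := by gcongr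
        _ = 1 := by rw [← Real.exp_add]; simp
    refine ae_eventually_of_measure_le
      (summable_geometric_of_lt_one (by positivity) hr) ?_
    filter_upwards [eventually_gt_atTop 1] with N hN
    have hm : MeasurableSet {g : Fin N → ℂ | (1 - a) * sqNorm g ≤ (1 - a) * (a * N)} :=
      measurableSet_le (by fun_prop) (by fun_prop)
    simp_rw [not_lt]
    rw [(hh N hN).measure_eq (p := fun g => (1 - a) * sqNorm g ≤ (1 - a) * (a * N)) hm]
    exact gaussianVector_sqNorm_tail_le N ha
  refine ae_tendsto_of_forall_lt_gt (fun a ha => ?_) (fun a ha => ?_)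
  -- The threshold is raised to stay positive, as the Chernoff bound requires.
  · have hb : max a (1 / 2) < 1 := max_lt ha (by norm_num)
    filter_upwards [key (max a (1 / 2)) (lt_max_of_lt_right (by norm_num)) hb.ne] with ω hω
    filter_upwards [hω, eventually_gt_atTop 0] with N hN hN0
    have hN0' : (0 : ℝ) < N := by exact_mod_cast hN0
    rw [mul_lt_mul_iff_right₀ (by linarith)] at hN
    rw [lt_div_iff₀ hN0']
    exact lt_of_le_of_lt (by gcongr; exact le_max_left _ _) hN
  · filter_upwards [key a (by linarith) ha.ne'] with ω hω
    filter_upwards [hω, eventually_gt_atTop 0] with N hN hN0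
    have hN0' : (0 : ℝ) < N := by exact_mod_cast hN0
    rw [div_lt_iff₀ hN0']
    exact lt_of_mul_lt_mul_left (by linarith : (a - 1) * _ < (a - 1) * _) (by linarith)

/-- Given `h`, the gain of `g` along its direction is exponential of mean one, so it exceeds `a N /
2` with probability at most `exp (-a N / 2)`. -/
lemma ae_tendsto_sq_norm_inner_div [IsProbabilityMeasure μ] {h g : (N : ℕ) → Ω → Fin N → ℂ}
    (hh : ∀ N, 1 < N → HasLaw (h N) (gaussianVector N 1) μ)
    (hg : ∀ N, 1 < N → HasLaw (g N) (gaussianVector N 1) μ)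
    (hhg : ∀ N, 1 < N → IndepFun (h N) (g N) μ) :
    ∀ᵐ ω ∂μ, Tendsto (fun N : ℕ =>
      ‖∑ i, g N ω i * star (h N ω i)‖ ^ 2 / (N * sqNorm (h N ω))) atTop (𝓝 0) := by
  refine ae_tendsto_of_forall_lt_gt (fun a ha => ?_) (fun a ha => ?_)
  · exact ae_of_all _ fun ω => Eventually.of_forall fun N => ha.trans_le
      (div_nonneg (by positivity) (mul_nonneg N.cast_nonneg (sqNorm_nonneg _)))
  · have hae : ∀ᵐ ω ∂μ, ∀ᶠ N : ℕ in atTop,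
        ‖∑ i, g N ω i * star (h N ω i)‖ ^ 2 ≤ (a / 2 * N) * sqNorm (h N ω) := by
      refine ae_eventually_of_measure_le (f := fun N => Real.exp (-(a / 2 * N)))
        (summable_exp_of_tendsto_div (L := -(a / 2)) (by linarith [show 0 < a from ha]) ?_) ?_
      · refine tendsto_const_nhds.congr' ?_
        filter_upwards [eventually_gt_atTop 0] with N hN0
        have hN0' : (0 : ℝ) < N := by exact_mod_cast hN0
        field_simp
      · filter_upwards [eventually_gt_atTop 1] with N hN
        simp_rw [not_le]
        exact measure_lt_sq_norm_inner_le (hh N hN) (hg N hN) (hhg N hN) _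
    filter_upwards [hae] with ω hω
    filter_upwards [hω] with N hN
    have ha' : 0 < a := ha
    refine lt_of_le_of_lt (div_le_of_le_mul₀ (mul_nonneg N.cast_nonneg (sqNorm_nonneg _))
      (by positivity : 0 ≤ a / 2) ?_) (by linarith)
    linarith

end AlmostSure

/-! ### Random codebooks: existence and scarcity of near codewords -/

section Codebook

variable {Ω : Type*} [MeasurableSpace Ω] {μ : Measure Ω} [IsProbabilityMeasure μ]
  {B : ℕ → ℕ} {Bbar : ℝ}

lemma tendsto_rate_div (hBbar : Tendsto (fun N : ℕ => (B N : ℝ) / (N : ℝ)) atTop (𝓝 Bbar))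
    (a b : ℝ) :
    Tendsto (fun N : ℕ => (B N * a + ((N - 1 : ℕ) : ℝ) * b) / (N : ℝ)) atTop
      (𝓝 (Bbar * a + b)) := by
  have h1 : Tendsto (fun N : ℕ => (B N : ℝ) / (N : ℝ) * a + (1 - 1 / (N : ℝ)) * b) atTop
      (𝓝 (Bbar * a + (1 - 0) * b)) :=
    (hBbar.mul_const a).add
      ((tendsto_const_nhds.sub tendsto_one_div_atTop_nhds_zero_nat).mul_const b)
  rw [sub_zero, one_mul] at h1
  refine h1.congr' ?_
  filter_upwards [eventually_gt_atTop 0] with N hN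
  have hN' : (0 : ℝ) < N := by exact_mod_cast hN
  rw [Nat.cast_sub hN, Nat.cast_one]
  field_simp

lemma two_pow_mul_pow_eq_exp {x : ℝ} (hx : 0 < x) (b n : ℕ) :
    (2 : ℝ) ^ b * x ^ n = Real.exp (b * Real.log 2 + n * Real.log x) := by
  rw [Real.exp_add, Real.exp_nat_mul, Real.exp_nat_mul, Real.exp_log two_pos, Real.exp_log hx]

variable {h g : (N : ℕ) → Ω → Fin N → ℂ}
  {C : (N : ℕ) → Fin (2 ^ B N) → Ω → Matrix (Fin N) (Fin 1) ℂ}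

/-- A union bound over the codebook with terms `x ^ (N - 1) * exp (-ε N)`. Negative `ε` is
permitted: the conclusion on `g` is then impossible, so the lemma says that no codeword is near. -/
lemma ae_eventually_near_imp_le
    (hBbar : Tendsto (fun N : ℕ => (B N : ℝ) / (N : ℝ)) atTop (𝓝 Bbar))
    (hh : ∀ N, 1 < N → HasLaw (h N) (gaussianVector N 1) μ)
    (hg : ∀ N, 1 < N → HasLaw (g N) (gaussianVector N 1) μ)
    (hhg : ∀ N, 1 < N → IndepFun (h N) (g N) μ)
    (hCmeas : ∀ N : ℕ, 1 < N → ∀ i, AEMeasurable (C N i) μ)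
    (hClaw : ∀ N : ℕ, 1 < N → ∀ i, IsIsotropicUnitary (μ.map (C N i)))
    (hhgC : ∀ N : ℕ, 1 < N → ∀ i, IndepFun (fun ω => (h N ω, g N ω)) (C N i) μ)
    {x ε : ℝ} (hx : 0 < x) (hx1 : x ≤ 1) (hε : Bbar * Real.log 2 + Real.log x - ε < 0) :
    ∀ᵐ ω ∂μ, ∀ᶠ N : ℕ in atTop, ∀ i,
      (1 - x) * sqNorm (h N ω) ≤ ‖∑ k, h N ω k * C N i ω k 0‖ ^ 2 →
        ‖∑ k, g N ω k * C N i ω k 0‖ ^ 2 ≤ ε * N := by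
  refine ae_eventually_of_measure_le (f := fun N : ℕ =>
    Real.exp (B N * Real.log 2 + ((N - 1 : ℕ) : ℝ) * Real.log x - ε * N))
    (summable_exp_of_tendsto_div hε ?_) ?_
  · refine ((tendsto_rate_div hBbar (Real.log 2) (Real.log x)).sub_const ε).congr' ?_
    filter_upwards [eventually_gt_atTop 0] with N hN
    have hN' : (0 : ℝ) < N := by exact_mod_cast hN
    field_simp
  · filter_upwards [eventually_gt_atTop 1] with N hN
    calc μ {ω | ¬ ∀ i, (1 - x) * sqNorm (h N ω) ≤ ‖∑ k, h N ω k * C N i ω k 0‖ ^ 2 →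
          ‖∑ k, g N ω k * C N i ω k 0‖ ^ 2 ≤ ε * N}
        ≤ μ (⋃ i, {ω | (1 - x) * sqNorm (h N ω) ≤ ‖∑ k, h N ω k * C N i ω k 0‖ ^ 2 ∧
          ε * N < ‖∑ k, g N ω k * C N i ω k 0‖ ^ 2}) := by
          refine measure_mono fun ω hω => ?_
          simpa using hω
      _ ≤ ∑ i : Fin (2 ^ B N), ENNReal.ofReal (x ^ (N - 1) * Real.exp (-(ε * N))) :=
          (measure_iUnion_fintype_le _ _).trans (Finset.sum_le_sum fun i _ =>
            measure_near_and_lt_sq_norm_le (by omega) (hh N hN) (hg N hN) (hhg N hN)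
              (hCmeas N hN i) (hClaw N hN i) (hhgC N hN i) hx hx1 _)
      _ = _ := by
          rw [Finset.sum_const, Finset.card_univ, Fintype.card_fin, nsmul_eq_mul,
            ← ENNReal.ofReal_natCast, ← ENNReal.ofReal_mul (by positivity), ← mul_assoc]
          congr 1
          rw [Nat.cast_pow, Nat.cast_ofNat, two_pow_mul_pow_eq_exp hx, ← Real.exp_add,
            sub_eq_add_neg]

/-- The failure probability is at most `exp (-2 ^ B * x ^ (N - 1))`, doubly exponentially small; the
cruder `exp (-exp u) ≤ exp (-u)` is already summable. -/
lemma ae_eventually_exists_near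
    (hBbar : Tendsto (fun N : ℕ => (B N : ℝ) / (N : ℝ)) atTop (𝓝 Bbar))
    (hh : ∀ N, 1 < N → HasLaw (h N) (gaussianVector N 1) μ)
    (hCmeas : ∀ N : ℕ, 1 < N → ∀ i, AEMeasurable (C N i) μ)
    (hClaw : ∀ N : ℕ, 1 < N → ∀ i, IsIsotropicUnitary (μ.map (C N i)))
    (hCindep : ∀ N : ℕ, 1 < N → iIndepFun (C N) μ)
    (hhC : ∀ N : ℕ, 1 < N → IndepFun (h N) (fun ω => fun i => C N i ω) μ)
    {x : ℝ} (hx : 0 < x) (hx1 : x ≤ 1) (hrate : 0 < Bbar * Real.log 2 + Real.log x) :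
    ∀ᵐ ω ∂μ, ∀ᶠ N : ℕ in atTop, ∃ i,
      (1 - x) * sqNorm (h N ω) ≤ ‖∑ k, h N ω k * C N i ω k 0‖ ^ 2 := by
  refine ae_eventually_of_measure_le (f := fun N : ℕ =>
    Real.exp (-(B N * Real.log 2 + ((N - 1 : ℕ) : ℝ) * Real.log x)))
    (summable_exp_of_tendsto_div (L := -(Bbar * Real.log 2 + Real.log x)) (by linarith) ?_) ?_
  · refine (tendsto_rate_div hBbar (Real.log 2) (Real.log x)).neg.congr fun N => ?_
    ring
  · filter_upwards [eventually_gt_atTop 1] with N hN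
    simp_rw [not_exists, not_le]
    refine (measure_forall_far_le (by omega) (hh N hN) (hCmeas N hN) (hClaw N hN)
      (hCindep N hN) (hhC N hN) hx hx1).trans (ENNReal.ofReal_le_ofReal ?_)
    rw [Fintype.card_fin]
    set u : ℝ := B N * Real.log 2 + ((N - 1 : ℕ) : ℝ) * Real.log x with hu
    have h1 : 0 ≤ 1 - x ^ (N - 1) := sub_nonneg.2 (pow_le_one₀ hx.le hx1)
    calc (1 - x ^ (N - 1)) ^ 2 ^ B N ≤ Real.exp (-x ^ (N - 1)) ^ 2 ^ B N := by
          refine pow_le_pow_left₀ h1 ?_ _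
          have := Real.add_one_le_exp (-x ^ (N - 1))
          linarith
      _ = Real.exp (-Real.exp u) := by
          rw [← Real.exp_nat_mul, hu, ← two_pow_mul_pow_eq_exp hx]
          congr 1
          push_cast
          ring
      _ ≤ Real.exp (-u) := by
          refine Real.exp_le_exp.2 (neg_le_neg ?_)
          have := Real.add_one_le_exp u
          linarith

end Codebook

/-! ### Passage to the limit -/

lemma tendsto_secrecyRateLoss {P β γ D : ℝ} (hP : 0 < P) (hβ : 0 < β) (hγ : 0 < γ) (hD : 0 ≤ D)
    (hD1 : D ≤ 1) {a b p q r d e : ℕ → ℝ} (ha : Tendsto a atTop (𝓝 (P / β)))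
    (hb : Tendsto b atTop (𝓝 P)) (hp : Tendsto p atTop (𝓝 1)) (hq : Tendsto q atTop (𝓝 1))
    (hr : Tendsto r atTop (𝓝 0)) (hd : Tendsto d atTop (𝓝 D)) (he : Tendsto e atTop (𝓝 0)) :
    Tendsto (fun N => (Real.log (1 + p N * a N) -
        Real.log (1 + r N * a N / (b N * (q N - r N) + γ))) -
      (Real.log (1 + p N * (1 - d N) * a N / (b N * (p N * d N) + 1)) -
        Real.log (1 + e N * a N / (b N * (q N - e N) + γ)))) atTop
      (𝓝 (Real.log (1 + P / β) + Real.log (1 + D * P) -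
        Real.log (1 + P + (1 - β) / β * (1 - D) * P))) := by
  have hD' : 0 ≤ 1 - D := by linarith
  have hPD : 0 ≤ P * D := by positivity
  have h1 : Tendsto (fun N => Real.log (1 + p N * a N)) atTop (𝓝 (Real.log (1 + 1 * (P / β)))) :=
    (tendsto_const_nhds.add (hp.mul ha)).log (by positivity)
  have h2 : ∀ {s : ℕ → ℝ}, Tendsto s atTop (𝓝 0) →
      Tendsto (fun N => Real.log (1 + s N * a N / (b N * (q N - s N) + γ))) atTop
        (𝓝 (Real.log (1 + 0 * (P / β) / (P * (1 - 0) + γ)))) := fun hs =>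
    (tendsto_const_nhds.add ((hs.mul ha).div
      ((hb.mul (hq.sub hs)).add_const γ) (by positivity))).log (by simp)
  have h3 : Tendsto (fun N => Real.log (1 + p N * (1 - d N) * a N / (b N * (p N * d N) + 1))) atTop
        (𝓝 (Real.log (1 + 1 * (1 - D) * (P / β) / (P * (1 * D) + 1)))) :=
    (tendsto_const_nhds.add (((hp.mul (hd.const_sub 1)).mul ha).div
      ((hb.mul (hp.mul hd)).add_const 1) (by positivity))).log (by positivity)
  -- Bob's quantized rate: over the common denominator `1 + D * P`, the numerator `1 + D * P + (1 -
  -- D) * P / β` is the argument of the last logarithm of the limit.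
  have h4 : Real.log (1 + 1 * (1 - D) * (P / β) / (P * (1 * D) + 1)) =
      Real.log (1 + P + (1 - β) / β * (1 - D) * P) - Real.log (1 + D * P) := by
    have e1 : 1 + P + (1 - β) / β * (1 - D) * P = 1 + D * P + (1 - D) * (P / β) := by
      field_simp
      ring
    have e2 : 1 + 1 * (1 - D) * (P / β) / (P * (1 * D) + 1) =
        (1 + P + (1 - β) / β * (1 - D) * P) / (1 + D * P) := by
      rw [e1, eq_div_iff (by positivity)]
      have : P * (1 * D) + 1 ≠ 0 := by positivity
      field_simp
      ring
    rw [e2, Real.log_div _ (by positivity)]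
    rw [e1]
    positivity
  have h5 := (h1.sub (h2 hr)).sub (h3.sub (h2 he))
  rw [h4] at h5
  convert h5 using 2
  simp only [zero_mul, zero_div, add_zero, Real.log_one, one_mul]
  ring

lemma measurable_row {n : ℕ} : Measurable fun A : Matrix (Fin 1) (Fin n) ℂ => A 0 :=
  measurable_pi_apply (X := fun _ : Fin 1 => Fin n → ℂ) 0

lemma measurePreserving_row_gaussianMatrix (n : ℕ) (v : ℝ≥0) :
    MeasurePreserving (fun A : Matrix (Fin 1) (Fin n) ℂ => A 0) (gaussianMatrix 1 n v)
      (gaussianVector n v) :=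
  measurePreserving_eval (fun _ : Fin 1 => gaussianVector n v) 0

lemma IsUnitaryPrecoder.secrecyRate_eq {n k : ℕ} {V : Matrix (Fin n) (Fin 1) ℂ}
    {Z : Matrix (Fin n) (Fin k) ℂ} (h : IsUnitaryPrecoder V Z) (H G : Matrix (Fin 1) (Fin n) ℂ)
    (σu2 σv2 : ℝ≥0) {σB2 σE2 : ℝ≥0} (hB : σB2 ≠ 0) (hE : σE2 ≠ 0) :
    secrecyRate H G V Z σu2 σv2 σB2 σE2 =
      Real.log (1 + ‖(H * V) 0 0‖ ^ 2 * σu2 / (σv2 * (sqNorm (H 0) - ‖(H * V) 0 0‖ ^ 2) + σB2)) -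
      Real.log (1 + ‖(G * V) 0 0‖ ^ 2 * σu2 /
        (σv2 * (sqNorm (G 0) - ‖(G * V) 0 0‖ ^ 2) + σE2)) := by
  rw [secrecyRate, channelInfo_eq_log _ _ _ _ _ hB, channelInfo_eq_log _ _ _ _ _ hE,
    ← h.sqNorm_add H, ← h.sqNorm_add G, add_sub_cancel_left, add_sub_cancel_left]

lemma tendsto_mul_signal_variance {P β : ℝ} (hβ : 0 < β) {σu2 σv2 : ℕ → ℝ≥0}
    (hratio : ∀ N : ℕ, 1 < N → (σv2 N : ℝ) / (σu2 N : ℝ) = β)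
    (hpower : ∀ N : ℕ, 1 < N → (σu2 N : ℝ) * 1 + (σv2 N : ℝ) * ((N : ℝ) - 1) = P) :
    Tendsto (fun N : ℕ => (N : ℝ) * σu2 N) atTop (𝓝 (P / β)) ∧
      Tendsto (fun N : ℕ => (N : ℝ) * σv2 N) atTop (𝓝 P) := by
  have hv : ∀ N : ℕ, 1 < N → (σv2 N : ℝ) = β * σu2 N := by
    intro N hN
    -- Division by zero gives zero, so a vanishing signal variance would contradict `β > 0`.
    have h0 : (σu2 N : ℝ) ≠ 0 := by
      intro h0
      have := hratio N hN
      rw [h0, div_zero] at this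
      exact hβ.ne this
    rw [← hratio N hN, div_mul_cancel₀ _ h0]
  have hu : Tendsto (fun N : ℕ => (N : ℝ) * σu2 N) atTop (𝓝 (P / β)) := by
    have h1 : Tendsto (fun N : ℕ => P / ((1 - β) * (1 / (N : ℝ)) + β)) atTop
        (𝓝 (P / ((1 - β) * 0 + β))) :=
      tendsto_const_nhds.div ((tendsto_one_div_atTop_nhds_zero_nat.const_mul _).add_const β)
        (by simpa using hβ.ne')
    rw [mul_zero, zero_add] at h1
    refine h1.congr' ?_
    filter_upwards [eventually_gt_atTop 1] with N hN
    have hN' : (1 : ℝ) < N := by exact_mod_cast hN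
    have hp := hpower N hN
    rw [hv N hN] at hp
    have hden : 0 < 1 + β * ((N : ℝ) - 1) := by
      have : 0 < (N : ℝ) - 1 := by linarith
      positivity
    have e1 : (1 - β) * (1 / (N : ℝ)) + β = (1 + β * ((N : ℝ) - 1)) / N := by
      field_simp
      ring
    rw [e1, ← hp]
    field_simp
  refine ⟨hu, ?_⟩
  have h2 := hu.const_mul β
  rw [mul_div_cancel₀ _ hβ.ne'] at h2
  refine h2.congr' ?_
  filter_upwards [eventually_gt_atTop 1] with N hN
  rw [hv N hN]
  ring

theorem theorem3
    {Ω : Type*} [MeasurableSpace Ω] (μ : Measure Ω) [IsProbabilityMeasure μ]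
    -- total power, artificial-noise power allocation, Eve-to-Bob noise-power ratio
    (P β : ℝ) (γ : ℝ≥0) (hP : 0 < P) (hβ : 0 < β) (hγ : 0 < γ)
    -- number of feedback bits as a function of the number `N` of transmit antennas
    (B : ℕ → ℕ) (Bbar : ℝ) (hB : Tendsto B atTop atTop)
    (hBbar : Tendsto (fun N : ℕ => (B N : ℝ) / (N : ℝ)) atTop (𝓝 Bbar))
    -- noise variances at Bob (normalized) and at Eve
    (σB2 σE2 : ℝ≥0) (hσB2 : σB2 = 1) (hσE2 : σE2 / σB2 = γ)
    -- variances of the entries of the information vector and of the artificial noise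
    (σu2 σv2 : ℕ → ℝ≥0)
    (hratio : ∀ N : ℕ, 1 < N → (σv2 N : ℝ) / (σu2 N : ℝ) = β)
    (hpower : ∀ N : ℕ, 1 < N → (σu2 N : ℝ) * 1 + (σv2 N : ℝ) * ((N : ℝ) - 1) = P)
    -- main channel, eavesdropper's channel and random codebook
    (H G : (N : ℕ) → Ω → Matrix (Fin 1) (Fin N) ℂ)
    (C : (N : ℕ) → Fin (2 ^ B N) → Ω → Matrix (Fin N) (Fin 1) ℂ)
    (hH : ∀ N : ℕ, 1 < N → HasLaw (H N) (gaussianMatrix 1 N 1) μ)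
    (hG : ∀ N : ℕ, 1 < N → HasLaw (G N) (gaussianMatrix 1 N 1) μ)
    (hCmeas : ∀ N : ℕ, 1 < N → ∀ i, AEMeasurable (C N i) μ)
    (hClaw : ∀ N : ℕ, 1 < N → ∀ i, IsIsotropicUnitary (μ.map (C N i)))
    (hCindep : ∀ N : ℕ, 1 < N → iIndepFun (C N) μ)
    (hHG : ∀ N : ℕ, 1 < N → IndepFun (H N) (G N) μ)
    (hHGC : ∀ N : ℕ, 1 < N →
      IndepFun (fun ω => (H N ω, G N ω)) (fun ω => fun i => C N i ω) μ)
    -- perfect-CSI precoder: `[V, Z]` is unitary and the columns of `Z` span the null space of `H`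
    (V : (N : ℕ) → Ω → Matrix (Fin N) (Fin 1) ℂ)
    (Z : (N : ℕ) → Ω → Matrix (Fin N) (Fin (N - 1)) ℂ)
    (hVZ : ∀ N : ℕ, 1 < N → ∀ᵐ ω ∂μ,
      IsUnitaryPrecoder (V N ω) (Z N ω) ∧ H N ω * Z N ω = 0)
    -- index fed back by Bob
    (j : (N : ℕ) → Ω → Fin (2 ^ B N))
    (hj : ∀ N : ℕ, 1 < N → ∀ᵐ ω ∂μ, ∀ i,
      chordalDist (C N (j N ω) ω) (V N ω) ^ 2 ≤ chordalDist (C N i ω) (V N ω) ^ 2)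
    -- quantized-CSI precoder: the selected codeword, completed to a unitary matrix
    (Zhat : (N : ℕ) → Ω → Matrix (Fin N) (Fin (N - 1)) ℂ)
    (hZhat : ∀ N : ℕ, 1 < N → ∀ᵐ ω ∂μ,
      IsUnitaryPrecoder (C N (j N ω) ω) (Zhat N ω)) :
    ∀ᵐ ω ∂μ, Tendsto
      (fun N : ℕ =>
        secrecyRate (H N ω) (G N ω) (V N ω) (Z N ω) (σu2 N) (σv2 N) σB2 σE2
          - secrecyRate (H N ω) (G N ω) (C N (j N ω) ω) (Zhat N ω) (σu2 N) (σv2 N) σB2 σE2)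
      atTop
      (𝓝 (Real.log (1 + P / β) + Real.log (1 + (2 : ℝ) ^ (-Bbar) * P)
        - Real.log (1 + P + (1 - β) / β * (1 - (2 : ℝ) ^ (-Bbar)) * P))) := by

  subst hσB2
  rw [div_one] at hσE2
  subst hσE2
  have hH' : ∀ N : ℕ, 1 < N → HasLaw (fun ω => H N ω 0) (gaussianVector N 1) μ := fun N hN =>
    (measurePreserving_row_gaussianMatrix N 1).fun_comp_hasLaw (hH N hN)
  have hG' : ∀ N : ℕ, 1 < N → HasLaw (fun ω => G N ω 0) (gaussianVector N 1) μ := fun N hN =>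
    (measurePreserving_row_gaussianMatrix N 1).fun_comp_hasLaw (hG N hN)
  have hHG' : ∀ N : ℕ, 1 < N → IndepFun (fun ω => H N ω 0) (fun ω => G N ω 0) μ := fun N hN =>
    (hHG N hN).comp measurable_row measurable_row
  have hHC' : ∀ N : ℕ, 1 < N → IndepFun (fun ω => H N ω 0) (fun ω => fun i => C N i ω) μ :=
    fun N hN => (hHGC N hN).comp (measurable_row.comp measurable_fst) measurable_id
  have hHGC' : ∀ N : ℕ, 1 < N → ∀ i,
      IndepFun (fun ω => (H N ω 0, G N ω 0)) (C N i) μ := fun N hN i =>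
    (hHGC N hN).comp ((measurable_row.comp measurable_fst).prodMk
      (measurable_row.comp measurable_snd)) (measurable_pi_apply i)
  have hBbar0 : 0 ≤ Bbar := ge_of_tendsto' hBbar fun N => by positivity
  set D : ℝ := (2 : ℝ) ^ (-Bbar) with hD
  have hD0 : 0 < D := Real.rpow_pos_of_pos two_pos _
  have hD1 : D ≤ 1 := Real.rpow_le_one_of_one_le_of_nonpos (by norm_num) (by linarith)
  have hlogD : Real.log D = -(Bbar * Real.log 2) := by
    rw [hD, Real.log_rpow two_pos, neg_mul]
  have hVZ' : ∀ᵐ ω ∂μ, ∀ N : ℕ, 1 < N →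
      IsUnitaryPrecoder (V N ω) (Z N ω) ∧ H N ω * Z N ω = 0 :=
    ae_all_iff.2 fun N => ae_all_iff.2 fun hN => hVZ N hN
  have hj' : ∀ᵐ ω ∂μ, ∀ N : ℕ, 1 < N → ∀ i,
      chordalDist (C N (j N ω) ω) (V N ω) ^ 2 ≤ chordalDist (C N i ω) (V N ω) ^ 2 :=
    ae_all_iff.2 fun N => ae_all_iff.2 fun hN => hj N hN
  have hZhat' : ∀ᵐ ω ∂μ, ∀ N : ℕ, 1 < N →
      IsUnitaryPrecoder (C N (j N ω) ω) (Zhat N ω) :=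
    ae_all_iff.2 fun N => ae_all_iff.2 fun hN => hZhat N hN
  have hCorth : ∀ᵐ ω ∂μ, ∀ N : ℕ, 1 < N → ∀ i, (C N i ω)ᴴ * C N i ω = 1 :=
    ae_all_iff.2 fun N => ae_all_iff.2 fun hN => ae_all_iff.2 fun i =>
      ae_of_ae_map (hCmeas N hN i) (hClaw N hN i).orthonormal
  have hp := ae_tendsto_sqNorm_div hH'
  have hq := ae_tendsto_sqNorm_div hG'
  have hr := ae_tendsto_sq_norm_inner_div hH' hG' hHG'
  -- Distances to codewords are nonnegative by Cauchy–Schwarz, so minimizing `d²` minimizes `d`,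
  -- that is, maximizes Bob's gain.
  have hsel : ∀ᵐ ω ∂μ, ∀ᶠ N : ℕ in atTop, ∀ i,
      ‖∑ k, H N ω 0 k * C N i ω k 0‖ ^ 2 ≤
        ‖∑ k, H N ω 0 k * C N (j N ω) ω k 0‖ ^ 2 := by
    filter_upwards [hVZ', hj', hCorth, hp] with ω h1 h2 h3 h4
    filter_upwards [eventually_gt_atTop 1, h4.eventually_const_lt zero_lt_one] with N hN hpos i
    have hs : 0 < sqNorm (H N ω 0) := by
      by_contra hs
      exact absurd hpos (not_lt.2 (div_nonpos_of_nonpos_of_nonneg (not_lt.1 hs) N.cast_nonneg))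
    have h5 := h2 N hN i
    rw [(h1 N hN).1.chordalDist_eq (h1 N hN).2 hs, (h1 N hN).1.chordalDist_eq (h1 N hN).2 hs] at h5
    have h6 : 0 ≤ 1 - ‖∑ k, H N ω 0 k * C N i ω k 0‖ ^ 2 / sqNorm (H N ω 0) :=
      sub_nonneg.2 ((div_le_one hs).2 (sq_norm_sum_mul_le _ (h3 N hN i)))
    have h7 := abs_le_of_sq_le_sq' h5 h6
    have h8 : ‖∑ k, H N ω 0 k * C N i ω k 0‖ ^ 2 / sqNorm (H N ω 0) ≤
        ‖∑ k, H N ω 0 k * C N (j N ω) ω k 0‖ ^ 2 / sqNorm (H N ω 0) := by linarith [h7.2]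
    exact (div_le_div_iff_of_pos_right hs).1 h8
  -- The case `x = 1` holds trivially; it is needed when `D = 1`, where no `x` lies strictly between
  -- `D` and `1`.
  have hnear : ∀ x : ℝ, 0 < x → (x = 1 ∨ (D < x ∧ x < 1)) → ∀ᵐ ω ∂μ, ∀ᶠ N : ℕ in atTop,
      (1 - x) * sqNorm (H N ω 0) ≤ ‖∑ k, H N ω 0 k * C N (j N ω) ω k 0‖ ^ 2 := by
    rintro x hx0 (rfl | ⟨hDx, hx1⟩)
    · refine ae_of_all _ fun ω => Eventually.of_forall fun N => ?_
      rw [sub_self, zero_mul]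
      positivity
    · have hrate : 0 < Bbar * Real.log 2 + Real.log x := by
        have := Real.log_lt_log hD0 hDx
        linarith
      filter_upwards [hsel, ae_eventually_exists_near hBbar hH' hCmeas hClaw hCindep hHC' hx0 hx1.le
        hrate] with ω h1 h2
      filter_upwards [h1, h2] with N h3 ⟨i, hi⟩
      exact hi.trans (h3 i)
  have hd : ∀ᵐ ω ∂μ, Tendsto (fun N : ℕ =>
      1 - ‖∑ k, H N ω 0 k * C N (j N ω) ω k 0‖ ^ 2 / sqNorm (H N ω 0)) atTop (𝓝 D) := by
    refine ae_tendsto_of_forall_lt_gt (fun a ha => ?_) (fun a ha => ?_)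
    -- The maximum keeps `x` positive for any `a < D`. The negative `ε` used below excludes all
    -- codewords at distance at most `x`.
    · set x := max a (D / 2) with hx
      have hx0 : 0 < x := lt_max_of_lt_right (by linarith)
      have hxD : x < D := max_lt ha (by linarith)
      have hlog := Real.log_lt_log hx0 hxD
      filter_upwards [ae_eventually_near_imp_le hBbar hH' hG' hHG' hCmeas hClaw hHGC' hx0
        (hxD.le.trans hD1) (ε := (Bbar * Real.log 2 + Real.log x) / 2) (by linarith), hp]
        with ω h1 h2
      filter_upwards [h1, h2.eventually_const_lt zero_lt_one, eventually_gt_atTop 1]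
        with N h3 hpos hN
      have hN0 : (0 : ℝ) < N := by exact_mod_cast (by omega : 0 < N)
      have hs : 0 < sqNorm (H N ω 0) := by
        have := (lt_div_iff₀ hN0).1 hpos
        rwa [zero_mul] at this
      have h4 : ‖∑ k, H N ω 0 k * C N (j N ω) ω k 0‖ ^ 2 < (1 - x) * sqNorm (H N ω 0) := by
        by_contra h5
        have h6 := h3 _ (not_lt.1 h5)
        have h7 : (Bbar * Real.log 2 + Real.log x) / 2 * N < 0 :=
          mul_neg_of_neg_of_pos (by linarith) hN0
        exact absurd (h6.trans_lt h7) (not_lt.2 (by positivity))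
      have h8 := (div_lt_iff₀ hs).2 h4
      have h9 : a ≤ x := le_max_left _ _
      linarith
    · have ha' : D < a := ha
      rcases le_or_gt a 1 with ha1 | ha1
      · filter_upwards [hnear ((D + a) / 2) (by linarith) (Or.inr ⟨by linarith, by linarith⟩), hp]
          with ω h1 h2
        filter_upwards [h1, h2.eventually_const_lt zero_lt_one, eventually_gt_atTop 1]
          with N h3 hpos hN
        have hN0 : (0 : ℝ) < N := by exact_mod_cast (by omega : 0 < N)
        have hs : 0 < sqNorm (H N ω 0) := by
          have := (lt_div_iff₀ hN0).1 hpos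
          rwa [zero_mul] at this
        have h8 := (le_div_iff₀ hs).2 h3
        linarith
      · refine ae_of_all _ fun ω => Eventually.of_forall fun N => ?_
        have : 0 ≤ ‖∑ k, H N ω 0 k * C N (j N ω) ω k 0‖ ^ 2 / sqNorm (H N ω 0) :=
          div_nonneg (by positivity) (sqNorm_nonneg _)
        linarith
  have he : ∀ᵐ ω ∂μ, Tendsto (fun N : ℕ =>
      ‖∑ k, G N ω 0 k * C N (j N ω) ω k 0‖ ^ 2 / N) atTop (𝓝 0) := by
    refine ae_tendsto_of_forall_lt_gt (fun a ha => ?_) (fun a ha => ?_)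
    · exact ae_of_all _ fun ω => Eventually.of_forall fun N => ha.trans_le (by positivity)
    · have ha' : 0 < a := ha
      -- Slightly above `D`, or equal to `1`: the selected codeword is eventually within `x`, while
      -- near codewords number about `exp (a N / 4)` at most, which the factor `exp (-a N / 2)`
      -- beats.
      set x := min 1 (D * Real.exp (a / 4)) with hx
      have hx0 : 0 < x := lt_min one_pos (by positivity)
      have hx1 : x ≤ 1 := min_le_left _ _
      have hlog : Real.log x ≤ Real.log D + a / 4 := by
        rw [← Real.log_exp (a / 4), ← Real.log_mul hD0.ne' (Real.exp_pos _).ne']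
        exact Real.log_le_log hx0 (min_le_right _ _)
      have hxD : x = 1 ∨ (D < x ∧ x < 1) := by
        rcases hx1.eq_or_lt with h1 | h1
        · exact Or.inl h1
        · refine Or.inr ⟨?_, h1⟩
          have h2 : x = D * Real.exp (a / 4) :=
            (min_choice 1 (D * Real.exp (a / 4))).resolve_left h1.ne
          rw [h2]
          exact lt_mul_of_one_lt_right hD0 (Real.one_lt_exp_iff.2 (by linarith))
      filter_upwards [ae_eventually_near_imp_le hBbar hH' hG' hHG' hCmeas hClaw hHGC' hx0 hx1
        (ε := a / 2) (by linarith), hnear x hx0 hxD] with ω h1 h2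
      filter_upwards [h1, h2, eventually_gt_atTop 0] with N h3 h4 hN
      have hN0 : (0 : ℝ) < N := by exact_mod_cast hN
      have h5 := (div_le_iff₀ hN0).2 (h3 _ h4)
      linarith
  obtain ⟨hu, hv⟩ := tendsto_mul_signal_variance hβ hratio hpower
  filter_upwards [hVZ', hZhat', hp, hq, hr, hd, he] with ω h1 h2 h3 h4 h5 h6 h7
  refine (tendsto_secrecyRateLoss hP hβ (NNReal.coe_pos.2 hγ) hD0.le hD1 hu hv h3 h4 h5 h6
    h7).congr' ?_
  -- Eventually `h ≠ 0`, which the cancellations of `sqNorm (H N ω 0)` below require.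
  filter_upwards [h3.eventually_const_lt zero_lt_one, eventually_gt_atTop 1] with N hpos hN
  have hN0 : (0 : ℝ) < N := by exact_mod_cast (by omega : 0 < N)
  have hs : 0 < sqNorm (H N ω 0) := by
    have := (lt_div_iff₀ hN0).1 hpos
    rwa [zero_mul] at this
  obtain ⟨hun, hZ0⟩ := h1 N hN
  rw [hun.secrecyRate_eq _ _ _ _ one_ne_zero hγ.ne',
    (h2 N hN).secrecyRate_eq _ _ _ _ one_ne_zero hγ.ne', hun.sq_norm_mul_eq hZ0,
    ← hun.sq_norm_mul_mul_sqNorm hZ0]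
  simp only [← Matrix.mul_apply, NNReal.coe_one, sub_self, mul_zero, zero_add, div_one]
  have c1 : sqNorm (H N ω 0) / N * (N * σu2 N) = sqNorm (H N ω 0) * σu2 N := by field_simp
  have c2 : ‖(G N ω * V N ω) 0 0‖ ^ 2 * sqNorm (H N ω 0) / (N * sqNorm (H N ω 0)) =
      ‖(G N ω * V N ω) 0 0‖ ^ 2 / N := by field_simp
  have c3 : ∀ s : ℝ, s / N * (N * σu2 N) = s * σu2 N := fun s => by field_simp
  have c4 : ∀ s t : ℝ, N * σv2 N * (t / N - s / N) = σv2 N * (t - s) := fun s t => by field_simp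
  have c5 : ∀ s : ℝ, sqNorm (H N ω 0) / N * (1 - (1 - s / sqNorm (H N ω 0))) * (N * σu2 N) =
      s * σu2 N := fun s => by field_simp; ring
  have c6 : ∀ s : ℝ, N * σv2 N * (sqNorm (H N ω 0) / N * (1 - s / sqNorm (H N ω 0))) =
      σv2 N * (sqNorm (H N ω 0) - s) := fun s => by field_simp
  rw [c1, c2, c3, c3, c4, c4, c5, c6]
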